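/- **Conventions.** A partition $\Delta=1^{m_1(\Delta)}2^{m_2(\Delta)}\cdots$ of any nonnegative integer has size $|\Delta|=\sum_i i\,m_i(\Delta)$, length $l(\Delta)=\sum_i m_i(\Delta)$, and $\|\Delta\|=\prod_i i^{m_i(\Delta)}$; sums of partitions are sums of multiplicities; $x_\Delta=\prod_i x_i^{m_i(\Delta)}$ and $\partial/\partial p_\Delta=\prod_i\partial^{m_i(\Delta)}/\partial p_i^{m_i(\Delta)}$. **Hurwitz numbers.** For $g,n\ge 0$, partitions $\Delta_1,\dots,\Delta_r$ and an integer $h$ with $(2-2g)n-(2-2h)=\sum_i(|\Delta_i|-l(\Delta_i))$, let $\mu_g^{h,n}(\Delta_1,\dots,\Delta_r)$ be the number of isomorphism classes of degree-$n$ (possibly disconnected) coverings of a closed genus-$g$ surface with ramification profiles $[\Delta_i,1^{n-|\Delta_i|}]$, each weighted by $1/|\mathrm{Aut}|$. That is, $\mu_g^{h,n}(\Delta_1,\dots,\Delta_r)$ is $\frac1{n!}$ times the number of tuples $(a_1,b_1,\dots,a_g,b_g,s_1,\dots,s_r)$ in $S_n$ with $\prod_j[a_j,b_j]\prod_i s_i=1$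 and $s_i$ of cycle type $[\Delta_i,1^{n-|\Delta_i|}]$. It is $0$ if some $|\Delta_i|>n$ or if $h$ does not satisfy the formula. Put $$U_g^{h,n}(\Delta_1,\dots,\Delta_r)=\prod_i\binom{n-|\Delta_i|+m_1(\Delta_i)}{m_1(\Delta_i)}\;\mu_g^{h,n}(\Delta_1,\dots,\Delta_r),$$ and let $CU_g^{h,n}$ be the same number with only connected coverings counted (transitive tuples, $n\ge1$). **Operators.** For a partition $\Delta$ and variables $q=(q_1,q_2,\dots)$ that differ from the time variables $p=(p_1,p_2,\dots)$ by constants, let $$W_q(\Delta,z)=\sum\frac{z^{|\Delta|-l(\Delta)+l(\Gamma')-l(\Gamma)}}{|\mathrm{Aut}|}\;\prod_i\Big[\|\Gamma_i'\|\,\delta_{|\Gamma_i|,|\Gamma_i'|}\,CU_0^{h_i,|\Gamma_i'|}(\Gamma_i',\Delta^i,\Gamma_i)\Big]\;q_{\Gamma}\,\frac{\partial}{\partial p_{\Gamma'}},$$ where the sum is over all finite unordered families of triples $(\Gamma_i',\Delta^i,\Gamma_i)$ of partitions with $\sum_i\Delta^i=\Delta$ and $|\Delta^i|\ge1$; $\Gamma'=\sum_i\Gamma_i'$,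 $\Gamma=\sum_i\Gamma_i$; $|\mathrm{Aut}|$ is the number of permutations of the index set preserving the family; and $2h_i-2=|\Delta^i|-l(\Delta^i)-l(\Gamma'_i)-l(\Gamma_i)$. Let $W(\Delta,z)$ denote $W_q(\Delta,z)$ for the shifted time variables $q_a=p_a+\delta_{a,1}$. **Generating function.** For partitions $\Delta_1,\dots,\Delta_m$ and $k\ge 0$ put $$\Phi_g^{(n)}\{z|(u_1,\Delta_1),\dots,(u_m,\Delta_m)|p^{(1)},\dots,p^{(k)},p\}=\sum_{l_1,\dots,l_m\ge0}\ \sum_{\Gamma,\Gamma_1,\dots,\Gamma_k}z^{2h-2}\,U_g^{h,n}(\underbrace{\Delta_1,\dots,\Delta_1}_{l_1},\dots,\underbrace{\Delta_m,\dots,\Delta_m}_{l_m},\Gamma_1,\dots,\Gamma_k,\Gamma)\prod_{j}\frac{u_j^{l_j}}{l_j!}\prod_i p^{(i)}_{\Gamma_i}\;p_\Gamma ,$$ with $h$ determined by the Riemann–Hurwitz formula, and $\Phi_g=\sum_{n\ge0}\Phi_g^{(n)}$. All series are formal in $u_j,p^{(i)}_a,p_a$, with exponents of $z$ ranging over $\mathbb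 Z$ (possibly unbounded in both directions). A formal sum is called well defined if every monomial in $z,u_j,p^{(i)}_a,p_a$ has a nonzero coefficient in only finitely many terms. **Statement.** 1. The sum defining $W(\Delta,z)F$ is well defined for every partition $\Delta$ and every such formal series $F$. 2. For all $g,n,m,k\ge0$ and all $\Delta_1,\dots,\Delta_m$, the series $\Phi_g^{(n)}$ is well defined and $$\Phi_g^{(n)}\{z|(u_1,\Delta_1),\dots,(u_m,\Delta_m)|p^{(1)},\dots,p^{(k)},p\}=\Big[\prod_{i=1}^m\exp\big(u_iW(\Delta_i,z)\big)\Big]\Phi_g^{(n)}\{z||p^{(1)},\dots,p^{(k)},p\}.$$ 3. If $g\neq1$, then the series $\Phi_g$ is well defined and $$\Phi_g\{z|(u_1,\Delta_1),\dots,(u_m,\Delta_m)|p^{(1)},\dots,p^{(k)},p\}=\Big[\prod_{i=1}^m\exp\big(u_iW(\Delta_i,z)\big)\Big]\Phi_g\{z||p^{(1)},\dots,p^{(k)},p\}.$$ 4. $\Phi_0\{z||p\}=\exp\big((p_1+1)/z^2\big)$, where the exponential series is well defined. -/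

import Mathlib

noncomputable section

namespace ShiftedHurwitz

open Equiv

/-! ### Partitions -/

/-- A partition `Δ = 1^{m₁} 2^{m₂} 3^{m₃} ⋯` of an arbitrary nonnegative integer, given by its
multiplicities `m_i(Δ)`. The sum of partitions is the sum of the multiplicities. -/
abbrev Ptn := ℕ+ →₀ ℕ

/-- `|Δ| = ∑ i m_i(Δ)`. -/
def size (Δ : Ptn) : ℕ := Δ.sum fun i m => (i : ℕ) * m

/-- `l(Δ) = ∑ m_i(Δ)`. -/
def len (Δ : Ptn) : ℕ := Δ.sum fun _ m => m

/-- `‖Δ‖ = ∏ i ^ m_i(Δ)`. -/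
def partsProd (Δ : Ptn) : ℕ := Δ.prod fun i m => (i : ℕ) ^ m

/-! ### Hurwitz numbers -/

/-- The permutation `f` of `n` points has cycle type `[Δ, 1^{n-|Δ|}]` (in particular `|Δ| ≤ n`). -/
def HasShiftedType {n : ℕ} (Δ : Ptn) (f : Perm (Fin n)) : Prop :=
  size Δ ≤ n ∧
    f.partition.parts = (Finsupp.toMultiset Δ).map (fun i : ℕ+ => (i : ℕ)) +
      Multiset.replicate (n - size Δ) 1

/-- The monodromy data of the degree `n` coverings (with labelled sheets) of a closed connected
surface of genus `g`, with ramification of type `[Δᵢ, 1^{n-|Δᵢ|}]` over the `i`-th branch point: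
`∏ⱼ [aⱼ, bⱼ] * ∏ᵢ sᵢ = 1`, where `[a, b] = a b a⁻¹ b⁻¹`. -/
def monodromies (g n : ℕ) (L : List Ptn) :
    Set ((Fin g → Perm (Fin n) × Perm (Fin n)) × (Fin L.length → Perm (Fin n))) :=
  {x | (∀ i, HasShiftedType (L.get i) (x.2 i)) ∧
    (List.ofFn fun j => (x.1 j).1 * (x.1 j).2 * (x.1 j).1⁻¹ * (x.1 j).2⁻¹).prod *
      (List.ofFn x.2).prod = 1}

/-- The covering surface is connected: the monodromy group is transitive on the (nonempty) fibre. -/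
def IsConnectedData {g n r : ℕ}
    (x : (Fin g → Perm (Fin n) × Perm (Fin n)) × (Fin r → Perm (Fin n))) : Prop :=
  0 < n ∧ MulAction.IsPretransitive
    (Subgroup.closure
      (Set.range (fun j => (x.1 j).1) ∪ Set.range (fun j => (x.1 j).2) ∪ Set.range x.2)) (Fin n)

/-- `∑ᵢ (|Δᵢ| - l(Δᵢ))`. -/
def totalColength (L : List Ptn) : ℤ := (L.map fun Δ => (size Δ : ℤ) - len Δ).sum

/-- The Riemann-Hurwitz formula for a degree `n` covering of a surface of genus `g` by a (maybe
disconnected) surface of genus `h`, i.e. of Euler characteristic `2 - 2h`. -/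
def RiemannHurwitz (g : ℕ) (h : ℤ) (n : ℕ) (L : List Ptn) : Prop :=
  (2 - 2 * (g : ℤ)) * n - (2 - 2 * h) = totalColength L

/-- The genus of the covering surface determined by the Riemann-Hurwitz formula. (When no integer
`h` satisfies the formula, the Hurwitz numbers are zero and this value is irrelevant.) -/
def sourceGenus (g n : ℕ) (L : List Ptn) : ℤ := ((2 * (g : ℤ) - 2) * n + totalColength L) / 2 + 1

open Classical in
/-- The classical Hurwitz number `μ_g^{h,n}(Δ₁, …, Δ_k)`: the number of isomorphism classes of
(maybe disconnected) coverings, each weighted by the inverse of the order of its automorphism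
group; that is, `1/n!` times the number of monodromy data. -/
def hurwitz (g : ℕ) (h : ℤ) (n : ℕ) (L : List Ptn) : ℚ :=
  if RiemannHurwitz g h n L then (Nat.card (monodromies g n L) : ℚ) / n.factorial else 0

open Classical in
/-- The connected version of `hurwitz`. -/
def connHurwitz (g : ℕ) (h : ℤ) (n : ℕ) (L : List Ptn) : ℚ :=
  if RiemannHurwitz g h n L then
    (Nat.card {x : monodromies g n L // IsConnectedData x.1} : ℚ) / n.factorial
  else 0

/-- `∏ᵢ binom (n - |Δᵢ| + m₁(Δᵢ)) (m₁(Δᵢ))`. It only multiplies numbers that vanish unless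
`|Δᵢ| ≤ n` for all `i`. -/
def shiftFactor (n : ℕ) (L : List Ptn) : ℚ :=
  (L.map fun Δ => ((n - size Δ + Δ 1).choose (Δ 1) : ℚ)).prod

/-- The shifted Hurwitz number `U_g^{h,n}(Δ₁, …, Δ_k)`. -/
def shiftedHurwitz (g : ℕ) (h : ℤ) (n : ℕ) (L : List Ptn) : ℚ :=
  shiftFactor n L * hurwitz g h n L

/-- The connected shifted Hurwitz number `CU_g^{h,n}(Δ₁, …, Δ_k)`. -/
def connShiftedHurwitz (g : ℕ) (h : ℤ) (n : ℕ) (L : List Ptn) : ℚ :=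
  shiftFactor n L * connHurwitz g h n L

/-! ### Formal series -/

/-- The indeterminates other than `z`: `u_j`, the time variables `p^{(i)}_a` and the time
variables `p_a`. -/
abbrev Var := ℕ ⊕ (ℕ × ℕ+) ⊕ ℕ+

/-- Formal power series in the variables `u_j`, `p^{(i)}_a`, `p_a`. -/
abbrev PS := MvPowerSeries Var ℚ

/-- The index of the variable `u_j`. -/
def uIdx (j : ℕ) : Var := Sum.inl j

/-- The index of the variable `p_a`. -/
def pIdx (a : ℕ+) : Var := Sum.inr (Sum.inr a)

/-- The variable `u_j`. -/
def uVar (j : ℕ) : PS := MvPowerSeries.X (uIdx j)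

/-- The time variable `p^{(i)}_a`. -/
def pOther (i : ℕ) (a : ℕ+) : PS := MvPowerSeries.X (Sum.inr (Sum.inl (i, a)))

/-- The time variable `p_a`. -/
def pVar (a : ℕ+) : PS := MvPowerSeries.X (pIdx a)

/-- The shifted time variable `p_a + δ_{a,1}`. -/
def pShift (a : ℕ+) : PS := pVar a + if a = 1 then 1 else 0

/-- `x_Γ = ∏ x_i ^ m_i(Γ)`. -/
def ptnPow (x : ℕ+ → PS) (Γ : Ptn) : PS := Γ.prod fun a m => x a ^ m

/-- `∂/∂p_Γ = ∏ ∂^{m_i(Γ)}/∂p_i^{m_i(Γ)}`. -/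
def ptnDeriv (Γ : Ptn) (P : PS) : PS :=
  (Γ.support.sort (· ≤ ·)).foldr (fun a Q => (MvPowerSeries.pderiv ℚ (pIdx a))^[Γ a] Q) P

/-- Formal series in `z`, `z⁻¹` and all the other variables: `F e` is the coefficient of `z^e`,
where the exponents `e` may be unbounded in both directions. -/
abbrev Series := ℤ → PS

/-- `z^c * P`. -/
def zMonomial (c : ℤ) (P : PS) : Series := Pi.single c P

/-- The coefficient of `z^e` times the monomial with exponent `M` in `F`. -/
def Series.coeff (F : Series) (e : ℤ) (M : Var →₀ ℕ) : ℚ := MvPowerSeries.coeff M (F e)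

/-- A family of series can be added up formally: every monomial has a nonzero coefficient in only
finitely many members of the family. -/
def FormallySummable {ι : Type*} (f : ι → Series) : Prop :=
  ∀ (e : ℤ) (M : Var →₀ ℕ), {i | (f i).coeff e M ≠ 0}.Finite

/-- The coefficientwise sum of a (formally summable) family of series. -/
def formalSum {ι : Type*} (f : ι → Series) : Series :=
  fun e M => ∑ᶠ i, (f i).coeff e M

/-- The terms of `exp (z^c P)`. -/
def expTerm (c : ℤ) (P : PS) (n : ℕ) : Series :=
  zMonomial (c * n) ((n.factorial : ℚ)⁻¹ • P ^ n)

/-- The formal exponential `exp (z^c P)`. -/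
def formalExp (c : ℤ) (P : PS) : Series := formalSum (expTerm c P)

/-- The terms `u_j^l/l! D^l F` of `exp (u_j D) F`. -/
def expOpTerm (j : ℕ) (D : Series → Series) (F : Series) (l : ℕ) : Series :=
  fun e => ((l.factorial : ℚ)⁻¹ • uVar j ^ l) * (D^[l] F) e

theorem expOpTerm_summable (j : ℕ) (D : Series → Series) (F : Series) :
    FormallySummable (expOpTerm j D F) := by
  intro e M
  refine (Set.finite_le_nat (M (uIdx j))).subset fun l hl => ?_
  by_contra hlt
  simp only [Set.mem_ofPred_eq, not_le] at hlt
  refine hl ?_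
  have h : (MvPowerSeries.X (uIdx j) : PS) ^ l ∣ expOpTerm j D F l e := by
    unfold expOpTerm uVar
    rw [smul_mul_assoc, ← mul_smul_comm]
    exact Dvd.intro _ rfl
  exact MvPowerSeries.X_pow_dvd_iff.1 h M hlt

/-- The operator `exp (u_j D)`. -/
def expOp (j : ℕ) (D : Series → Series) (F : Series) : Series := formalSum (expOpTerm j D F)

/-! ### Cut-and-join operators -/

/-- A triple `(Γ', Δ, Γ)` of partitions. -/
abbrev Triple := Ptn × Ptn × Ptn

/-- The unordered families of triples `(Γ'ᵢ, Δⁱ, Γᵢ)` in which `(Δ¹, Δ², …)` is a proper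
re-partition of `Δ`, i.e. `∑ Δⁱ = Δ` and `|Δⁱ| ≥ 1`. -/
abbrev Decomp (Δ : Ptn) :=
  {T : Multiset Triple // (T.map fun t => t.2.1).sum = Δ ∧ ∀ t ∈ T, 1 ≤ size t.2.1}

/-- The number of automorphisms of a family of triples: the permutations of the index set that
preserve the family. -/
def autCard (T : Multiset Triple) : ℕ := ∏ t ∈ T.toFinset, (T.count t).factorial

/-- The factor `‖Γ'‖ δ_{|Γ|,|Γ'|} CU_0^{h,|Γ'|}(Γ', Δ, Γ)`, where
`2h - 2 = |Δ| - l(Δ) - l(Γ') - l(Γ)`. -/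
def tripleWeight (t : Triple) : ℚ :=
  if size t.2.2 = size t.1 then
    partsProd t.1 * connShiftedHurwitz 0 (sourceGenus 0 (size t.1) [t.1, t.2.1, t.2.2])
      (size t.1) [t.1, t.2.1, t.2.2]
  else 0

/-- The term of the cut-and-join operator of `Δ` that belongs to the family `T`, applied to `F`.
It is `z^{|Δ|-l(Δ)+l(Γ')-l(Γ)} / |Aut| * ∏ (weights) * q_Γ ∂/∂p_{Γ'}`, where `Γ' = ∑ Γ'ᵢ` and
`Γ = ∑ Γᵢ`: in normal order all multiplications stand in front of all derivatives. The operators of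
multiplication are those by `q_a`, where `q` is `pVar` or `pShift`. -/
def cutJoinTerm (q : ℕ+ → PS) (Δ : Ptn) (F : Series) (T : Decomp Δ) : Series :=
  let Γ' : Ptn := (T.1.map fun t => t.1).sum
  let Γ : Ptn := (T.1.map fun t => t.2.2).sum
  let c : ℤ := (size Δ : ℤ) - len Δ + len Γ' - len Γ
  fun e => ((T.1.map tripleWeight).prod / (autCard T.1 : ℚ)) •
    (ptnPow q Γ * ptnDeriv Γ' (F (e - c)))

/-- The cut-and-join operator `W(Δ, z)` written in the time variables `q` (which differ from the `p`
by constants, so that `∂/∂q = ∂/∂p`): `q = pVar` gives the operator in the variables `p_a`, and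
`q = pShift` the one in the variables `p_a + δ_{a,1}`. -/
def cutJoin (q : ℕ+ → PS) (Δ : Ptn) (F : Series) : Series := formalSum (cutJoinTerm q Δ F)

/-! ### Generating functions -/

/-- The branching data `Δ₁, …, Δ₁ (l₁ times), …, Δ_m, …, Δ_m (l_m times), Γ₁, …, Γ_k, Γ`. -/
def branching {m k : ℕ} (Δ : Fin m → Ptn) (l : Fin m → ℕ) (Γs : Fin k → Ptn) (Γ : Ptn) :
    List Ptn :=
  (List.ofFn fun j => List.replicate (l j) (Δ j)).flatten ++ List.ofFn Γs ++ [Γ]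

/-- The term of the generating function with indices `n`, `(l₁, …, l_m)`, `(Γ₁, …, Γ_k)`, `Γ`. -/
def genTerm (g : ℕ) {m : ℕ} (Δ : Fin m → Ptn) (k : ℕ) (n : ℕ)
    (x : (Fin m → ℕ) × (Fin k → Ptn) × Ptn) : Series :=
  let L := branching Δ x.1 x.2.1 x.2.2
  let h := sourceGenus g n L
  zMonomial (2 * h - 2) (shiftedHurwitz g h n L •
    ((∏ j : Fin m, (((x.1 j).factorial : ℚ)⁻¹ • uVar j ^ x.1 j)) *
      (∏ i : Fin k, ptnPow (pOther i) (x.2.1 i)) * ptnPow pVar x.2.2))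

/-- The part of the generating function that counts the coverings of degree `n`. -/
def genFunDeg (g : ℕ) {m : ℕ} (Δ : Fin m → Ptn) (k : ℕ) (n : ℕ) : Series :=
  formalSum (genTerm g Δ k n)

/-- The generating function `Φ_g{z | (u₁,Δ₁), …, (u_m,Δ_m) | p^{(1)}, …, p^{(k)}, p}`. -/
def genFun (g : ℕ) {m : ℕ} (Δ : Fin m → Ptn) (k : ℕ) : Series :=
  formalSum fun y : ℕ × (Fin m → ℕ) × (Fin k → Ptn) × Ptn => genTerm g Δ k y.1 y.2

/-- The operator `∏ⱼ exp (u_j W(Δ_j, z))` with `W(Δ_j, z)` in the shifted time variables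
`p_a + δ_{a,1}`; the factor with the smallest index stands leftmost. -/
def evolution {m : ℕ} (Δ : Fin m → Ptn) (F : Series) : Series :=
  (List.ofFn fun j : Fin m => expOp j (cutJoin pShift (Δ j))).foldr (fun E G => E G) F

end ShiftedHurwitz

end

set_option linter.unusedSectionVars false

noncomputable section

namespace ShiftedHurwitz

open Equiv

/-! ### Partitions and cycle types -/

/-! The factor binom(n-|Δ|+m₁(Δ), m₁(Δ)) counts the sets d ⊇ supp τ on which a permutation τ of type
[Δ, 1^{n-|Δ|}] has type exactly Δ. Let C_Δ be the sum of τ over all such pairs (τ, d), a central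
element of the group algebra. Then U_g^{h,n} is 1/n! times the coefficient of 1 in the g-th power of
the sum of commutators times the product of the C_{Δᵢ} (`shiftedHurwitz_eq`). In the sum over the
last profile a fixed point of τ contributes p₁ or 1, according to whether it lies in d
(`sum_domains`). So the generating function is a sum of images of group algebra elements under σ ↦
z^{c-l(σ)} P q_σ, in the shifted variables q (`sum_last`).

The core is that W(Δ, z) acts on such images as multiplication by C_Δ (`cutJoin_permSeries`). Since
‖Γ'‖ ∂/∂p_{Γ'} sends q_Λ to z_Λ/z_{Λ-Γ'} q_{Λ-Γ'}, the coefficient of q_Γ in the image of q_Λ is z_Λ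
times a sum over families of connected pieces with an untouched remainder. By the exponential
formula `configWeight_eq_familySum` this sum is 1/n! times the number of all (σ, τ, d) for which σ,
τ on d, and στ have types Λ, Δ, Γ: the orbits of ⟨σ, τ⟩ that meet d are the connected pieces, and on
the others τ is trivial. The proof of that formula marks a point of d and splits off its orbit; both
sides satisfy the resulting recursion in |Δ| and agree for |Δ| = 0.

As the C_Δ are central, the exponentials then produce all the branching data
(`evolution_permSeries`). Convergence is handled by `Finitary`: if each output coefficient is a
fixed finite combination of input coefficients, the operator commutes with formal sums. That W has
this property despite the constant in q₁ = p₁ + 1 rests on `fixed_le_of_tripleWeight_ne_zero`: in a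
connected piece every fixed point of στ lies in d, so m₁(Γ) ≤ |Δ|. For g ≠ 1 the exponent of z
determines n once the branching data are given, which allows summation over n. -/

theorem size_add (Δ Δ' : Ptn) : size (Δ + Δ') = size Δ + size Δ' := by
  unfold size
  exact Finsupp.sum_add_index' (by simp) (by intros; ring)

theorem len_add (Δ Δ' : Ptn) : len (Δ + Δ') = len Δ + len Δ' := by
  unfold len
  exact Finsupp.sum_add_index' (by simp) (by intros; ring)

@[simp] theorem size_zero : size 0 = 0 := by simp [size]

@[simp] theorem size_single (a : ℕ+) (m : ℕ) : size (Finsupp.single a m) = a * m := by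
  simp [size]

@[simp] theorem len_single (a : ℕ+) (m : ℕ) : len (Finsupp.single a m) = m := by
  simp [len]

/-- `size` as an additive homomorphism. -/
def sizeHom : Ptn →+ ℕ where
  toFun := size
  map_zero' := size_zero
  map_add' := size_add

theorem size_mono {Δ Δ' : Ptn} (h : Δ ≤ Δ') : size Δ ≤ size Δ' := by
  rw [← tsub_add_cancel_of_le h, size_add]; omega

theorem size_sub {Δ Δ' : Ptn} (h : Δ ≤ Δ') : size (Δ' - Δ) = size Δ' - size Δ := by
  conv_rhs => rw [← tsub_add_cancel_of_le h, size_add]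
  omega

theorem le_size (Δ : Ptn) (a : ℕ+) : a * Δ a ≤ size Δ := by
  have h : Finsupp.single a (Δ a) ≤ Δ := by
    intro b
    by_cases hb : a = b
    · subst hb; simp
    · simp [hb]
  simpa using size_mono h

theorem apply_le_size (Δ : Ptn) (a : ℕ+) : Δ a ≤ size Δ :=
  (Nat.le_mul_of_pos_left _ a.pos).trans (le_size Δ a)

theorem eq_zero_of_size_eq_zero {Δ : Ptn} (h : size Δ = 0) : Δ = 0 := by
  ext a
  have := apply_le_size Δ a
  simp; omega

theorem finite_size_le (K : ℕ) : {Δ : Ptn | size Δ ≤ K}.Finite := by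
  -- A part that occurs is at most |Δ| ≤ K, and so is its multiplicity. `K.succPNat` is K + 1, a
  -- positive bound even when K = 0.
  refine (Set.finite_Iic
    (∑ a ∈ Finset.Iic (K.succPNat), Finsupp.single a K : Ptn)).subset fun Δ hΔ a => ?_
  have h1 := le_size Δ a
  have h2 := apply_le_size Δ a
  simp only [Set.mem_ofPred_eq] at hΔ
  rw [Finsupp.finsetSum_apply]
  by_cases ha : a ≤ K.succPNat
  · rw [Finset.sum_eq_single a]
    · simp; omega
    · intro b _ hb
      simp [hb]
    · simp [ha]
  · have h3 : K + 1 < (a : ℕ) := by simpa [← PNat.coe_lt_coe] using ha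
    have : Δ a = 0 := by
      by_contra h0
      have : (a : ℕ) ≤ a * Δ a := Nat.le_mul_of_pos_right _ (Nat.pos_of_ne_zero h0)
      omega
    simp [this]

/-- The partition whose multiplicities are those of a multiset of numbers. -/
def ofParts (s : Multiset ℕ) : Ptn :=
  Finsupp.comapDomain (fun a : ℕ+ => (a : ℕ)) (Multiset.toFinsupp s) PNat.coe_injective.injOn

@[simp] theorem ofParts_apply (s : Multiset ℕ) (a : ℕ+) : ofParts s a = s.count (a : ℕ) := by
  simp [ofParts]

theorem ofParts_add (s t : Multiset ℕ) : ofParts (s + t) = ofParts s + ofParts t := by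
  ext a; simp

@[simp] theorem ofParts_zero : ofParts 0 = 0 := by ext a; simp

theorem ofParts_replicate_one (k : ℕ) :
    ofParts (Multiset.replicate k 1) = Finsupp.single 1 k := by
  ext a
  rw [ofParts_apply, Multiset.count_replicate, Finsupp.single_apply]
  simp only [← PNat.coe_eq_one_iff, eq_comm]

/-- The parts of a partition. -/
def parts (Δ : Ptn) : Multiset ℕ := (Finsupp.toMultiset Δ).map fun i : ℕ+ => (i : ℕ)

theorem parts_add (Δ Δ' : Ptn) : parts (Δ + Δ') = parts Δ + parts Δ' := by
  simp [parts]

theorem parts_single_one (k : ℕ) : parts (Finsupp.single 1 k) = Multiset.replicate k 1 := by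
  simp [parts, Finsupp.toMultiset_single, Multiset.nsmul_singleton]

theorem count_parts (Δ : Ptn) (a : ℕ+) : (parts Δ).count (a : ℕ) = Δ a := by
  rw [parts, Multiset.count_map_eq_count' _ _ PNat.coe_injective, Finsupp.count_toMultiset]

theorem ofParts_parts (Δ : Ptn) : ofParts (parts Δ) = Δ := by
  ext a; rw [ofParts_apply, count_parts]

theorem parts_ofParts {s : Multiset ℕ} (hs : ∀ a ∈ s, 0 < a) : parts (ofParts s) = s := by
  ext a
  rcases Nat.eq_zero_or_pos a with rfl | ha
  · rw [Multiset.count_eq_zero_of_notMem, Multiset.count_eq_zero_of_notMem]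
    · exact fun h => lt_irrefl _ (hs 0 h)
    · simp [parts]
  · exact (count_parts _ ⟨a, ha⟩).trans (ofParts_apply _ _)

theorem sum_parts (Δ : Ptn) : (parts Δ).sum = size Δ := by
  rw [parts, size, Finsupp.toMultiset_apply, Finsupp.sum, Finsupp.sum,
    ← Multiset.coe_mapAddMonoidHom, map_sum, ← Multiset.coe_sumAddMonoidHom, map_sum]
  simp [Multiset.map_nsmul, Multiset.sum_nsmul, mul_comm]

theorem card_parts (Δ : Ptn) : Multiset.card (parts Δ) = len Δ := by
  rw [parts, Multiset.card_map, Finsupp.card_toMultiset]; rfl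

theorem size_ofParts {s : Multiset ℕ} (hs : ∀ a ∈ s, 0 < a) : size (ofParts s) = s.sum := by
  rw [← sum_parts, parts_ofParts hs]

theorem len_ofParts {s : Multiset ℕ} (hs : ∀ a ∈ s, 0 < a) :
    len (ofParts s) = Multiset.card s := by
  rw [← card_parts, parts_ofParts hs]

/-! ### Cycle types on a domain and the size of conjugacy classes -/

section Types

variable {X Y : Type*} [Fintype X] [DecidableEq X] [Fintype Y] [DecidableEq Y]

theorem cycleType_pos (τ : Perm X) : ∀ a ∈ τ.cycleType, 0 < a :=
  fun _ ha => (zero_lt_two).trans_le (Perm.two_le_of_mem_cycleType ha)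

/-- The cycle type of `τ` as a permutation of a set `d` that contains its support. -/
def typeOn (τ : Perm X) (d : Finset X) : Ptn :=
  ofParts τ.cycleType + Finsupp.single 1 (d.card - τ.support.card)

/-- The cycle type of a permutation, fixed points included. -/
def ptype (σ : Perm X) : Ptn := typeOn σ Finset.univ

theorem ofParts_cycleType_one (τ : Perm X) : ofParts τ.cycleType 1 = 0 := by
  rw [ofParts_apply]
  refine Multiset.count_eq_zero_of_notMem fun h => ?_
  exact absurd (Perm.two_le_of_mem_cycleType h) (by simp)

theorem size_ofParts_cycleType (τ : Perm X) : size (ofParts τ.cycleType) = τ.support.card := by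
  rw [size_ofParts (cycleType_pos τ), Perm.sum_cycleType]

theorem size_typeOn {τ : Perm X} {d : Finset X} (h : τ.support ⊆ d) :
    size (typeOn τ d) = d.card := by
  rw [typeOn, size_add, size_ofParts_cycleType]
  have := Finset.card_le_card h
  rw [size_single, PNat.one_coe]; omega

theorem size_ptype (σ : Perm X) : size (ptype σ) = Fintype.card X :=
  (size_typeOn (Finset.subset_univ _)).trans Finset.card_univ

theorem typeOn_apply_one (τ : Perm X) (d : Finset X) :
    typeOn τ d 1 = d.card - τ.support.card := by
  rw [typeOn, Finsupp.add_apply, ofParts_cycleType_one]; simp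

/-- A further fixed point in `d` raises size and length by one each, so the choice of `d` does not
affect the exponent of z. -/
theorem colength_typeOn (τ : Perm X) {d : Finset X} (h : τ.support ⊆ d) :
    (size (typeOn τ d) : ℤ) - len (typeOn τ d) = Fintype.card X - len (ptype τ) := by
  rw [size_typeOn h, ptype, typeOn, typeOn, len_add, len_add]
  have := Finset.card_le_card h
  have := Finset.card_le_univ d
  rw [len_single, len_single, Finset.card_univ]; omega

theorem ofParts_partition (σ : Perm X) : ofParts σ.partition.parts = ptype σ := by
  rw [Perm.parts_partition, ofParts_add, ofParts_replicate_one, ptype, typeOn, Finset.card_univ]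

theorem typeOn_congr {τ : Perm X} {d : Finset X} {τ' : Perm Y} {d' : Finset Y}
    (h : τ.cycleType = τ'.cycleType) (hd : d.card = d'.card) : typeOn τ d = typeOn τ' d' := by
  rw [typeOn, typeOn, h, hd, ← Perm.sum_cycleType, ← Perm.sum_cycleType, h]

theorem ptype_inv (σ : Perm X) : ptype σ⁻¹ = ptype σ :=
  typeOn_congr (Perm.cycleType_inv σ) rfl

theorem ptype_eq_iff {σ τ : Perm X} : ptype σ = ptype τ ↔ IsConj σ τ := by
  rw [Perm.isConj_iff_cycleType_eq]
  constructor
  · intro h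
    have h' := congrArg parts h
    rw [← ofParts_partition, ← ofParts_partition, parts_ofParts, parts_ofParts] at h'
    · rw [← Perm.filter_parts_partition_eq_cycleType, ← Perm.filter_parts_partition_eq_cycleType,
        h']
    all_goals exact fun a ha => Nat.Partition.parts_pos _ ha
  · exact fun h => typeOn_congr h rfl

theorem cycleType_permCongr (e : X ≃ Y) (σ : Perm X) :
    (e.permCongr σ).cycleType = σ.cycleType := by
  -- Transport along `e` is extension of the domain along a predicate that always holds.
  rw [← Perm.cycleType_extendDomain (p := fun _ : Y => True)
    (e.trans (Equiv.subtypeUnivEquiv fun _ => trivial).symm) (g := σ)]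
  congr 1

theorem support_permCongr (e : X ≃ Y) (σ : Perm X) :
    (e.permCongr σ).support = σ.support.map e.toEmbedding := by
  ext y
  simp only [Perm.mem_support, Equiv.permCongr_apply, Finset.mem_map_equiv, ne_eq]
  rw [not_iff_not, ← Equiv.eq_symm_apply]

theorem typeOn_permCongr (e : X ≃ Y) (τ : Perm X) (d : Finset X) :
    typeOn (e.permCongr τ) (d.map e.toEmbedding) = typeOn τ d :=
  typeOn_congr (cycleType_permCongr e τ) (Finset.card_map _)

theorem ptype_permCongr (e : X ≃ Y) (τ : Perm X) : ptype (e.permCongr τ) = ptype τ :=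
  typeOn_congr (cycleType_permCongr e τ) (by
    rw [Finset.card_univ, Finset.card_univ, Fintype.card_congr e])

/-- `z_Λ = ‖Λ‖ ∏ m_i(Λ)!`. -/
def centralizerSize (Λ : Ptn) : ℕ := partsProd Λ * Λ.prod fun _ m => m.factorial

theorem partsProd_add (Δ Δ' : Ptn) : partsProd (Δ + Δ') = partsProd Δ * partsProd Δ' := by
  unfold partsProd
  exact Finsupp.prod_add_index' (by simp) (by intros; rw [pow_add])

theorem partsProd_pos (Δ : Ptn) : 0 < partsProd Δ :=
  Finset.prod_pos fun a _ => pow_pos a.pos _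

theorem centralizerSize_pos (Λ : Ptn) : 0 < centralizerSize Λ :=
  Nat.mul_pos (partsProd_pos Λ) (Finset.prod_pos fun _ _ => Nat.factorial_pos _)

theorem partsProd_eq (Λ : Ptn) : partsProd Λ = (parts Λ).prod := by
  rw [parts, partsProd, Finsupp.toMultiset_apply, Finsupp.prod, Finsupp.sum,
    ← Multiset.coe_mapAddMonoidHom, map_sum, Multiset.prod_sum]
  simp [Multiset.map_nsmul, Multiset.prod_nsmul]

/-- The centralizer rotates each cycle and permutes cycles of equal length. The count for cycle
types without fixed points is adapted by splitting the ones off Λ; they return as the factorial of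
the number of remaining points. -/
theorem card_ptype (Λ : Ptn) (h : size Λ = Fintype.card X) :
    (Finset.univ.filter fun σ : Perm X => ptype σ = Λ).card * centralizerSize Λ =
      (Fintype.card X).factorial := by
  set m := (parts Λ).filter (2 ≤ ·) with hm
  have hpos : ∀ a ∈ parts Λ, 0 < a := by
    intro a ha
    obtain ⟨b, -, rfl⟩ := Multiset.mem_map.1 ha
    exact b.pos
  have hsplit : parts Λ = m + Multiset.replicate (Λ 1) 1 := by
    rw [← Multiset.filter_add_not (2 ≤ ·) (parts Λ), hm]
    congr 1
    rw [← count_parts Λ 1, PNat.one_coe, ← Multiset.filter_eq']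
    refine Multiset.filter_congr fun a ha => ?_
    have := hpos a ha
    simp; omega
  have hmsum : m.sum + Λ 1 = Fintype.card X := by
    rw [← h, ← sum_parts, hsplit]; simp
  have hΛ : Λ = ofParts m + Finsupp.single 1 (Λ 1) := by
    rw [← ofParts_replicate_one, ← ofParts_add, ← hsplit, ofParts_parts]
  have hm2 : ∀ a ∈ m, 2 ≤ a := fun a ha => (Multiset.mem_filter.1 ha).2
  have key := Perm.card_of_cycleType_mul_eq X m
  rw [if_pos ⟨by omega, hm2⟩] at key
  rw [← key]
  congr 1
  · congr 1
    ext σ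
    simp only [Finset.mem_filter, Finset.mem_univ, true_and]
    constructor
    · intro hσ
      rw [← Perm.filter_parts_partition_eq_cycleType, hm, ← hσ, ← ofParts_partition,
        parts_ofParts fun a ha => σ.partition.parts_pos ha]
    · intro hσ
      rw [hΛ, ptype, typeOn, hσ, ← Perm.sum_cycleType, hσ, Finset.card_univ]
      congr 2; omega
  · have h1 : Fintype.card X - m.sum = Λ 1 := by omega
    have hm1 : m.count 1 = 0 := by
      rw [Multiset.count_eq_zero]; exact fun h => absurd (hm2 1 h) (by simp)
    rw [h1, centralizerSize, partsProd_eq, hsplit, Multiset.prod_add, Multiset.prod_replicate,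
      one_pow, mul_one, mul_comm (Nat.factorial _), mul_assoc]
    congr 1
    have e1 : (Λ.prod fun _ m => m.factorial) =
        ∏ n ∈ (parts Λ).toFinset, ((parts Λ).count n).factorial := by
      have : (parts Λ).toFinset = Λ.support.map ⟨fun a : ℕ+ => (a : ℕ), PNat.coe_injective⟩ := by
        ext n
        simp [parts]
      rw [this, Finset.prod_map, Finsupp.prod]
      exact Finset.prod_congr rfl fun a _ => by
        simp only [Function.Embedding.coeFn_mk, count_parts]
    rw [e1]
    -- The index 1 may be inserted even if it is not a part of Λ, since it then contributes 0! = 1.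
    have e2 : ∏ n ∈ (parts Λ).toFinset, ((parts Λ).count n).factorial =
        ∏ n ∈ insert 1 m.toFinset, ((parts Λ).count n).factorial := by
      refine Finset.prod_subset ?_ ?_
      · intro n hn
        rw [hsplit] at hn
        simp only [Multiset.toFinset_add, Finset.mem_union, Multiset.mem_toFinset,
          Multiset.mem_replicate, Finset.mem_insert] at hn ⊢
        tauto
      · intro n _ hn
        rw [Multiset.count_eq_zero_of_notMem (by simpa using hn)]; rfl
    rw [e2, Finset.prod_insert (by simpa using hm1)]
    congr 1
    · rw [hsplit]; simp [hm1]
    · refine Finset.prod_congr rfl fun n hn => ?_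
      have : n ≠ 1 := by
        rintro rfl; exact absurd (hm2 1 (by simpa using hn)) (by simp)
      rw [hsplit, Multiset.count_add, Multiset.count_replicate, if_neg (by tauto), add_zero]

end Types

/-! ### Shifted types and the choice of domains -/

/-- The ones appended to Δ merge with those in Δ, so only the parts greater than 1 are prescribed,
and m₁(Δ) is free as long as |Δ| ≤ n. -/
theorem hasShiftedType_iff {n : ℕ} {Δ : Ptn} {f : Perm (Fin n)} :
    HasShiftedType Δ f ↔ size Δ ≤ n ∧ Δ = ofParts f.cycleType + Finsupp.single 1 (Δ 1) := by
  unfold HasShiftedType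
  refine and_congr_right fun hn => ?_
  change _ = parts Δ + _ ↔ _
  have hs := f.support.card_le_univ
  rw [Fintype.card_fin] at hs
  constructor
  · intro h
    have h' := congrArg ofParts h
    rw [ofParts_partition, ofParts_add, ofParts_parts, ofParts_replicate_one, ptype, typeOn] at h'
    ext a
    have := DFunLike.congr_fun h' a
    by_cases ha : 1 = a
    · subst ha
      rw [Finsupp.add_apply, ofParts_cycleType_one]; simp
    · simpa [Finsupp.single_apply, ha] using this.symm
  · intro h
    have h1 : size Δ = f.support.card + Δ 1 := by
      conv_lhs => rw [h, size_add, size_ofParts_cycleType]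
      simp
    rw [Perm.parts_partition, Fintype.card_fin]
    conv_rhs => rw [h, parts_add, parts_single_one, parts_ofParts (cycleType_pos f), add_assoc,
      ← Multiset.replicate_add]
    rw [← h]
    congr 2; omega

/-- Such a `d` is the support together with m₁(Δ) of the n - |Δ| + m₁(Δ) fixed points. This is the
combinatorial meaning of the shift factor. -/
theorem card_domains {n : ℕ} (Δ : Ptn) (f : Perm (Fin n)) [Decidable (HasShiftedType Δ f)] :
    (Finset.univ.filter fun d => f.support ⊆ d ∧ typeOn f d = Δ).card =
      if HasShiftedType Δ f then (n - size Δ + Δ 1).choose (Δ 1) else 0 := by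
  have hs := f.support.card_le_univ
  rw [Fintype.card_fin] at hs
  split_ifs with h
  · obtain ⟨hn, h⟩ := hasShiftedType_iff.1 h
    have h1 : size Δ = f.support.card + Δ 1 := by
      conv_lhs => rw [h, size_add, size_ofParts_cycleType]
      simp
    have h2 : n - size Δ + Δ 1 = (f.supportᶜ).card := by
      rw [Finset.card_compl, Fintype.card_fin]; omega
    rw [h2, ← Finset.card_powersetCard]
    refine Finset.card_bij' (fun d _ => d \ f.support) (fun e _ => f.support ∪ e) ?_ ?_ ?_ ?_
    · intro d hd
      simp only [Finset.mem_filter, Finset.mem_univ, true_and] at hd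
      rw [Finset.mem_powersetCard, Finset.card_sdiff_of_subset hd.1, ← typeOn_apply_one, hd.2]
      exact ⟨fun x hx => by simp at hx ⊢; tauto, rfl⟩
    · intro e he
      rw [Finset.mem_powersetCard] at he
      have hdisj : Disjoint f.support e := (Finset.subset_compl_iff_disjoint_left).1 he.1
      simp only [Finset.mem_filter, Finset.mem_univ, true_and]
      refine ⟨Finset.subset_union_left, ?_⟩
      rw [typeOn, Finset.card_union_of_disjoint hdisj, he.2, add_tsub_cancel_left, ← h]
    · intro d hd
      simp only [Finset.mem_filter, Finset.mem_univ, true_and] at hd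
      exact Finset.union_sdiff_of_subset hd.1
    · intro e he
      rw [Finset.mem_powersetCard] at he
      have hdisj : Disjoint f.support e := (Finset.subset_compl_iff_disjoint_left).1 he.1
      exact Finset.union_sdiff_cancel_left hdisj
  · rw [Finset.card_eq_zero, Finset.filter_eq_empty_iff]
    rintro d - ⟨hd, rfl⟩
    refine h (hasShiftedType_iff.2 ⟨?_, ?_⟩)
    · rw [size_typeOn hd]; simpa using d.card_le_univ
    · rw [typeOn_apply_one]; rfl

/-! ### Pairs of permutations and their common orbits -/

section Configurations

variable {X Y : Type*} [Fintype X] [DecidableEq X] [Fintype Y] [DecidableEq Y]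

/-- A permutation `σ`, and a permutation `τ` with a set that is to contain the support of `τ`. -/
abbrev Config (X : Type*) := Perm X × Perm X × Finset X

/-- The triples `(σ, τ, d)` where the support of `τ` is contained in `d`. -/
def configs (X : Type*) [Fintype X] [DecidableEq X] : Finset (Config X) :=
  Finset.univ.filter fun x => x.2.1.support ⊆ x.2.2

theorem mem_configs {x : Config X} : x ∈ configs X ↔ x.2.1.support ⊆ x.2.2 := by
  simp [configs]

/-- The types of `σ`, of `τ` on `d`, and of `σ τ`. -/
def Config.type (x : Config X) : Triple := (ptype x.1, typeOn x.2.1 x.2.2, ptype (x.1 * x.2.1))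

/-- `S` is invariant under `σ` and `τ`. -/
def IsInvariant (x : Config X) (S : Finset X) : Prop :=
  ∀ a, (x.1 a ∈ S ↔ a ∈ S) ∧ (x.2.1 a ∈ S ↔ a ∈ S)

/-- `S` is an orbit of the group generated by `σ` and `τ`. -/
def IsComponent (x : Config X) (S : Finset X) : Prop :=
  IsInvariant x S ∧ S.Nonempty ∧ ∀ S' ⊆ S, IsInvariant x S' → S'.Nonempty → S' = S

theorem IsInvariant.sdiff {x : Config X} {S S' : Finset X} (h : IsInvariant x S)
    (h' : IsInvariant x S') : IsInvariant x (S \ S') := fun a => by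
  simp [(h a).1, (h a).2, (h' a).1, (h' a).2]

/-- The component is the intersection of all invariant sets through `p`. It is minimal: an invariant
proper part that avoids `p` would leave a smaller invariant set through `p` as its complement. -/
theorem existsUnique_component (x : Config X) (p : X) : ∃! S, IsComponent x S ∧ p ∈ S := by
  classical
  let S : Finset X := Finset.univ.filter fun y => ∀ S', IsInvariant x S' → p ∈ S' → y ∈ S'
  have hinv : IsInvariant x S := fun a => by
    constructor
    · simp only [S, Finset.mem_filter, Finset.mem_univ, true_and]
      exact forall₃_congr fun S' h _ => (h a).1
    · simp only [S, Finset.mem_filter, Finset.mem_univ, true_and]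
      exact forall₃_congr fun S' h _ => (h a).2
  have hp : p ∈ S := by simp [S]
  have hmin : ∀ S', IsInvariant x S' → p ∈ S' → S ⊆ S' := fun S' h hp y hy => by
    simp only [S, Finset.mem_filter, Finset.mem_univ, true_and] at hy
    exact hy S' h hp
  refine ⟨S, ⟨⟨hinv, ⟨p, hp⟩, fun S' hS' h hne => ?_⟩, hp⟩, ?_⟩
  · by_contra hcon
    by_cases hpS : p ∈ S'
    · exact hcon (hS'.antisymm (hmin S' h hpS))
    · obtain ⟨y, hy⟩ := hne
      have := hmin (S \ S') (hinv.sdiff h) (Finset.mem_sdiff.2 ⟨hp, hpS⟩) (hS' hy)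
      exact (Finset.mem_sdiff.1 this).2 hy
  · rintro T ⟨⟨hT, -, hTmin⟩, hpT⟩
    exact (hTmin S (hmin T hT hpT) hinv ⟨p, hp⟩).symm

/-! #### Glueing -/

section Glue

variable (S : Finset X)

/-- The disjoint union of configurations on `S` and on its complement. -/
def glue (y : Config {a // a ∈ S}) (z : Config {a // ¬a ∈ S}) : Config X :=
  (Perm.subtypeCongr y.1 z.1, Perm.subtypeCongr y.2.1 z.2.1,
    y.2.2.map (Function.Embedding.subtype _) ∪ z.2.2.map (Function.Embedding.subtype _))

theorem subtypeCongr_eq_mul (f : Perm {a // a ∈ S}) (g : Perm {a // ¬a ∈ S}) :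
    Perm.subtypeCongr f g = Perm.ofSubtype f * Perm.ofSubtype g := by
  ext a
  by_cases h : a ∈ S
  · rw [Perm.subtypeCongr.left_apply _ _ h, Perm.mul_apply,
      Perm.ofSubtype_apply_of_not_mem g (not_not.2 h), Perm.ofSubtype_apply_of_mem _ h]
  · rw [Perm.subtypeCongr.right_apply _ _ h, Perm.mul_apply,
      Perm.ofSubtype_apply_of_mem g h, Perm.ofSubtype_apply_of_not_mem]
    exact (g ⟨a, h⟩).2

theorem disjoint_map_subtype (s : Finset {a // a ∈ S}) (t : Finset {a // ¬a ∈ S}) :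
    Disjoint (s.map (Function.Embedding.subtype _)) (t.map (Function.Embedding.subtype _)) := by
  rw [Finset.disjoint_left]
  intro a ha hb
  obtain ⟨a, -, rfl⟩ := Finset.mem_map.1 ha
  obtain ⟨b, -, hb⟩ := Finset.mem_map.1 hb
  exact b.2 (by rw [show (b : X) = a from hb]; exact a.2)

theorem disjoint_ofSubtype (f : Perm {a // a ∈ S}) (g : Perm {a // ¬a ∈ S}) :
    Perm.Disjoint (Perm.ofSubtype f) (Perm.ofSubtype g) := by
  rw [Perm.disjoint_iff_disjoint_support, Perm.support_ofSubtype, Perm.support_ofSubtype]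
  exact disjoint_map_subtype S _ _

theorem support_subtypeCongr (f : Perm {a // a ∈ S}) (g : Perm {a // ¬a ∈ S}) :
    (Perm.subtypeCongr f g).support =
      f.support.map (Function.Embedding.subtype _) ∪
        g.support.map (Function.Embedding.subtype _) := by
  rw [subtypeCongr_eq_mul, (disjoint_ofSubtype S f g).support_mul, Perm.support_ofSubtype,
    Perm.support_ofSubtype]
  congr!

theorem typeOn_subtypeCongr (f : Perm {a // a ∈ S}) (g : Perm {a // ¬a ∈ S})
    {d : Finset {a // a ∈ S}} {e : Finset {a // ¬a ∈ S}} (hd : f.support ⊆ d)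
    (he : g.support ⊆ e) :
    typeOn (Perm.subtypeCongr f g)
      (d.map (Function.Embedding.subtype _) ∪ e.map (Function.Embedding.subtype _)) =
      typeOn f d + typeOn g e := by
  have hd' := Finset.card_le_card hd
  have he' := Finset.card_le_card he
  rw [typeOn, typeOn, typeOn, support_subtypeCongr,
    Finset.card_union_of_disjoint (disjoint_map_subtype S _ _),
    Finset.card_union_of_disjoint (disjoint_map_subtype S _ _), subtypeCongr_eq_mul,
    (disjoint_ofSubtype S f g).cycleType_mul, Perm.cycleType_ofSubtype, Perm.cycleType_ofSubtype,
    ofParts_add, Finset.card_map, Finset.card_map, Finset.card_map, Finset.card_map,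
    add_add_add_comm, ← Finsupp.single_add]
  -- The truncated differences add up because each support lies in its domain.
  congr 2; omega

theorem ptype_subtypeCongr (f : Perm {a // a ∈ S}) (g : Perm {a // ¬a ∈ S}) :
    ptype (Perm.subtypeCongr f g) = ptype f + ptype g := by
  rw [ptype, ptype, ptype, ← typeOn_subtypeCongr S f g (Finset.subset_univ _)
    (Finset.subset_univ _)]
  congr 1
  ext a
  by_cases h : a ∈ S <;> simp [h]

theorem glue_mem {y : Config {a // a ∈ S}} {z : Config {a // ¬a ∈ S}} (hy : y ∈ configs _)
    (hz : z ∈ configs _) : glue S y z ∈ configs X := by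
  rw [mem_configs] at *
  simp only [glue, support_subtypeCongr]
  exact Finset.union_subset_union (Finset.map_subset_map.2 hy) (Finset.map_subset_map.2 hz)

/-- Additivity of all three types is what lets the exponential formula run in the ordered monoid of
triples. -/
theorem type_glue {y : Config {a // a ∈ S}} {z : Config {a // ¬a ∈ S}} (hy : y ∈ configs _)
    (hz : z ∈ configs _) : (glue S y z).type = y.type + z.type := by
  rw [mem_configs] at hy hz
  have h : Perm.subtypeCongr y.1 z.1 * Perm.subtypeCongr y.2.1 z.2.1 =
      Perm.subtypeCongr (y.1 * y.2.1) (z.1 * z.2.1) :=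
    ((Perm.subtypeCongrHom (· ∈ S)).map_mul (y.1, z.1) (y.2.1, z.2.1)).symm
  simp only [glue, Config.type, h, ptype_subtypeCongr, typeOn_subtypeCongr S _ _ hy hz]
  rfl

theorem isInvariant_glue (y : Config {a // a ∈ S}) (z : Config {a // ¬a ∈ S}) :
    IsInvariant (glue S y z) S := fun a => by
  by_cases h : a ∈ S
  · simp [glue, h, Perm.subtypeCongr.left_apply]
  · simp only [glue, Perm.subtypeCongr.right_apply _ _ h, h, iff_false]
    exact ⟨(z.1 ⟨a, h⟩).2, (z.2.1 ⟨a, h⟩).2⟩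

theorem isInvariant_glue_map (y : Config {a // a ∈ S}) (z : Config {a // ¬a ∈ S})
    (T : Finset {a // a ∈ S}) :
    IsInvariant (glue S y z) (T.map (Function.Embedding.subtype _)) ↔ IsInvariant y T := by
  constructor
  · intro h a
    have := h a
    simpa [glue, Perm.subtypeCongr.left_apply] using this
  · intro h a
    by_cases ha : a ∈ S
    · have := h ⟨a, ha⟩
      simpa [glue, Perm.subtypeCongr.left_apply, ha] using this
    · have h1 := (z.1 ⟨a, ha⟩).2
      have h2 := (z.2.1 ⟨a, ha⟩).2
      simp [glue, Perm.subtypeCongr.right_apply, ha, h1, h2]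

theorem isComponent_glue (y : Config {a // a ∈ S}) (z : Config {a // ¬a ∈ S}) :
    IsComponent (glue S y z) S ↔ IsComponent y Finset.univ := by
  have hS : S = (Finset.univ : Finset {a // a ∈ S}).map (Function.Embedding.subtype _) := by
    ext a; simp
  constructor
  · rintro ⟨-, hne, hmin⟩
    refine ⟨fun a => by simp, ?_, fun T _ hT hTne => ?_⟩
    · obtain ⟨a, ha⟩ := hne
      exact ⟨⟨a, ha⟩, Finset.mem_univ _⟩
    · have := hmin (T.map (Function.Embedding.subtype _)) (fun a ha => by
        obtain ⟨b, -, rfl⟩ := Finset.mem_map.1 ha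
        exact b.2) ((isInvariant_glue_map S y z T).2 hT) (Finset.map_nonempty.2 hTne)
      exact Finset.map_injective _ (this.trans hS)
  · rintro ⟨-, ⟨a, -⟩, hmin⟩
    refine ⟨isInvariant_glue S y z, ⟨a, a.2⟩, fun T hTS hT hTne => ?_⟩
    have hT' : T = (T.subtype (· ∈ S)).map (Function.Embedding.subtype _) := by
      rw [Finset.subtype_map, Finset.filter_true_of_mem hTS]
    rw [hT', isInvariant_glue_map] at hT
    have := hmin _ (Finset.subset_univ _) hT (by
      rw [hT'] at hTne; exact Finset.map_nonempty.1 hTne)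
    rw [hT', this, ← hS]

theorem glue_injective {y y' : Config {a // a ∈ S}} {z z' : Config {a // ¬a ∈ S}}
    (h : glue S y z = glue S y' z') : y = y' ∧ z = z' := by
  simp only [glue, Prod.mk.injEq] at h
  obtain ⟨h1, h2, h3⟩ := h
  have e1 := Perm.subtypeCongrHom_injective (· ∈ S) (a₁ := (y.1, z.1)) (a₂ := (y'.1, z'.1)) h1
  have e2 := Perm.subtypeCongrHom_injective (· ∈ S) (a₁ := (y.2.1, z.2.1))
    (a₂ := (y'.2.1, z'.2.1)) h2
  simp only [Prod.mk.injEq] at e1 e2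
  refine ⟨Prod.ext e1.1 (Prod.ext e2.1 ?_), Prod.ext e1.2 (Prod.ext e2.2 ?_)⟩
  · ext ⟨a, ha⟩
    have := Finset.ext_iff.1 h3 a
    simpa [ha] using this
  · ext ⟨a, ha⟩
    have := Finset.ext_iff.1 h3 a
    simpa [ha] using this

theorem exists_glue_eq {x : Config X} (hx : x ∈ configs X) (h : IsInvariant x S) :
    ∃ y ∈ configs {a // a ∈ S}, ∃ z ∈ configs {a // ¬a ∈ S}, glue S y z = x := by
  refine ⟨(Perm.subtypePerm x.1 fun a => (h a).1, Perm.subtypePerm x.2.1 fun a => (h a).2,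
    x.2.2.subtype _), ?_,
    (Perm.subtypePerm x.1 fun a => not_congr (h a).1,
      Perm.subtypePerm x.2.1 fun a => not_congr (h a).2, x.2.2.subtype _), ?_, ?_⟩
  · rw [mem_configs] at *
    rintro ⟨a, ha⟩ hd
    rw [Finset.mem_subtype]
    refine hx ?_
    simp only [Perm.mem_support, Perm.subtypePerm_apply, ne_eq, Subtype.mk.injEq] at hd ⊢
    exact hd
  · rw [mem_configs] at *
    rintro ⟨a, ha⟩ hd
    rw [Finset.mem_subtype]
    refine hx ?_
    simp only [Perm.mem_support, Perm.subtypePerm_apply, ne_eq, Subtype.mk.injEq] at hd ⊢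
    exact hd
  · refine Prod.ext ?_ (Prod.ext ?_ ?_)
    · ext a
      by_cases ha : a ∈ S <;> simp [glue, ha]
    · ext a
      by_cases ha : a ∈ S <;> simp [glue, ha]
    · simp only [glue, Finset.subtype_map]
      exact Finset.filter_union_filter_not_eq _ _

open Classical in
-- A configuration that has `S` as a component splits uniquely into a connected one on `S` and an
-- arbitrary one on the complement.
theorem sum_isComponent {M : Type*} [AddCommMonoid M] (F : Config X → M) :
    ∑ x ∈ (configs X).filter (fun x => IsComponent x S), F x =
      ∑ y ∈ (configs {a // a ∈ S}).filter (fun y => IsComponent y Finset.univ),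
        ∑ z ∈ configs {a // ¬a ∈ S}, F (glue S y z) := by
  rw [← Finset.sum_product']
  symm
  refine Finset.sum_bij (fun yz _ => glue S yz.1 yz.2) ?_ ?_ ?_ fun _ _ => rfl
  · rintro ⟨y, z⟩ h
    simp only [Finset.mem_product, Finset.mem_filter] at h ⊢
    exact ⟨glue_mem S h.1.1 h.2, (isComponent_glue S y z).2 h.1.2⟩
  · rintro ⟨y, z⟩ - ⟨y', z'⟩ - h
    obtain ⟨rfl, rfl⟩ := glue_injective S h
    rfl
  · intro x hx
    rw [Finset.mem_filter] at hx
    obtain ⟨y, hy, z, hz, rfl⟩ := exists_glue_eq S hx.1 hx.2.1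
    refine ⟨(y, z), ?_, rfl⟩
    rw [Finset.mem_product, Finset.mem_filter]
    exact ⟨⟨hy, (isComponent_glue S y z).1 hx.2⟩, hz⟩

end Glue

/-! #### Counting -/

open Classical in
/-- The number of configurations of a given type. -/
def configCount (X : Type*) [Fintype X] [DecidableEq X] (κ : Triple) : ℕ :=
  ((configs X).filter fun x => x.type = κ).card

open Classical in
/-- The number of connected configurations of a given type. -/
def connCount (X : Type*) [Fintype X] [DecidableEq X] (κ : Triple) : ℕ :=
  ((configs X).filter fun x => IsComponent x Finset.univ ∧ x.type = κ).card

theorem card_domain {x : Config X} (hx : x ∈ configs X) : x.2.2.card = size x.type.2.1 :=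
  (size_typeOn (mem_configs.1 hx)).symm

open Classical in
-- Double counting of configurations with a marked point of `d`. The number of marked points is the
-- size of the middle type; each lies in exactly one component `S`, where it belongs to the domain
-- of the connected part.
theorem configCount_recursion (κ : Triple) :
    size κ.2.1 * configCount X κ = ∑ S : Finset X, ∑ κ' ∈ Finset.Iic κ,
      size κ'.2.1 * connCount {a // a ∈ S} κ' * configCount {a // ¬a ∈ S} (κ - κ') := by
  have hcomp : ∀ x : Config X, ∀ p : X,
      ∑ S : Finset X, (if IsComponent x S ∧ p ∈ S then 1 else 0) = 1 := by
    intro x p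
    obtain ⟨S, hS, huniq⟩ := existsUnique_component x p
    rw [Finset.sum_eq_single S (fun T _ hT => if_neg fun h => hT (huniq T h)) (by simp),
      if_pos hS]
  have step1 : size κ.2.1 * configCount X κ =
      ∑ S : Finset X, ∑ x ∈ (configs X).filter (fun x => IsComponent x S),
        if x.type = κ then (x.2.2 ∩ S).card else 0 := by
    calc size κ.2.1 * configCount X κ
        = ∑ x ∈ configs X, if x.type = κ then x.2.2.card else 0 := by
          rw [← Finset.sum_filter, configCount, mul_comm, ← smul_eq_mul, ← Finset.sum_const]
          refine Finset.sum_congr rfl fun x hx => ?_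
          rw [Finset.mem_filter] at hx
          rw [card_domain hx.1, hx.2]
      _ = ∑ x ∈ configs X, ∑ S : Finset X,
            if IsComponent x S then (if x.type = κ then (x.2.2 ∩ S).card else 0) else 0 := by
          refine Finset.sum_congr rfl fun x _ => ?_
          split_ifs with h
          · rw [Finset.card_eq_sum_ones, ← Finset.sum_congr rfl fun p _ => hcomp x p,
              Finset.sum_comm]
            refine Finset.sum_congr rfl fun S _ => ?_
            split_ifs with hS
            · rw [← Finset.filter_mem_eq_inter, Finset.card_filter]
              simp [hS]
            · simp [hS]
          · simp
      _ = _ := by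
          rw [Finset.sum_comm]
          exact Finset.sum_congr rfl fun S _ => (Finset.sum_filter _ _).symm
  rw [step1]
  refine Finset.sum_congr rfl fun S _ => ?_
  rw [sum_isComponent]
  -- The condition on the total type is expanded over the type `κ'` of `y`, which decouples the sums
  -- over `y` and `z`.
  calc _ = ∑ y ∈ (configs {a // a ∈ S}).filter (fun y => IsComponent y Finset.univ),
        ∑ z ∈ configs {a // ¬a ∈ S}, ∑ κ' ∈ Finset.Iic κ,
          size κ'.2.1 * (if y.type = κ' then 1 else 0) * (if z.type = κ - κ' then 1 else 0) := by
        refine Finset.sum_congr rfl fun y hy => Finset.sum_congr rfl fun z hz => ?_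
        rw [Finset.mem_filter] at hy
        rw [type_glue S hy.1 hz]
        have hcard : ((glue S y z).2.2 ∩ S).card = size y.type.2.1 := by
          rw [← card_domain hy.1, ← Finset.card_map (Function.Embedding.subtype (· ∈ S))]
          congr 1
          ext a
          by_cases ha : a ∈ S <;> simp [glue, ha]
        rw [hcard]
        by_cases hle : y.type ≤ κ
        · rw [Finset.sum_eq_single_of_mem y.type (Finset.mem_Iic.2 hle)]
          · have : y.type + z.type = κ ↔ z.type = κ - y.type := by
              rw [add_comm]
              exact (eq_tsub_iff_add_eq_of_le hle).symm
            simp [this]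
          · intro κ' _ hne
            simp [hne.symm]
        · have hne : y.type + z.type ≠ κ := by
            rintro rfl
            exact hle le_self_add
          rw [if_neg hne, Finset.sum_eq_zero]
          intro κ' hκ'
          rw [Finset.mem_Iic] at hκ'
          have : y.type ≠ κ' := fun h => hle (h ▸ hκ')
          simp [this]
    _ = _ := by
        rw [Finset.sum_congr rfl fun y _ => Finset.sum_comm, Finset.sum_comm]
        refine Finset.sum_congr rfl fun κ' _ => ?_
        simp only [← Finset.mul_sum, ← Finset.sum_mul, mul_assoc]
        rw [connCount, configCount, Finset.card_filter, Finset.card_filter, Finset.sum_filter]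
        congr 2
        exact Finset.sum_congr rfl fun y _ => by split_ifs <;> simp_all

/-! #### Transport -/

/-- Transport of a configuration. -/
def Config.congr (e : X ≃ Y) : Config X ≃ Config Y :=
  Equiv.prodCongr e.permCongr (Equiv.prodCongr e.permCongr e.finsetCongr)

theorem type_congr (e : X ≃ Y) (x : Config X) : (Config.congr e x).type = x.type := by
  simp only [Config.type, Config.congr, Equiv.prodCongr_apply, Prod.map_fst, Prod.map_snd,
    Equiv.finsetCongr_apply, ptype_permCongr, typeOn_permCongr]
  have : e.permCongr x.1 * e.permCongr x.2.1 = e.permCongr (x.1 * x.2.1) := by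
    ext a; simp
  rw [this, ptype_permCongr]

theorem congr_mem_configs (e : X ≃ Y) (x : Config X) :
    Config.congr e x ∈ configs Y ↔ x ∈ configs X := by
  simp [mem_configs, Config.congr, support_permCongr]

theorem isInvariant_congr (e : X ≃ Y) (x : Config X) (S : Finset X) :
    IsInvariant (Config.congr e x) (S.map e.toEmbedding) ↔ IsInvariant x S := by
  unfold IsInvariant
  rw [← e.forall_congr_right]
  simp [Config.congr]

theorem isComponent_congr (e : X ≃ Y) (x : Config X) :
    IsComponent (Config.congr e x) Finset.univ ↔ IsComponent x Finset.univ := by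
  unfold IsComponent
  rw [← e.finsetCongr.forall_congr_right]
  simp only [Equiv.finsetCongr_apply, isInvariant_congr, Finset.map_nonempty, Finset.subset_univ,
    true_imp_iff]
  have h1 : (Finset.univ : Finset Y) = Finset.univ.map e.toEmbedding := by simp
  rw [h1, isInvariant_congr, Finset.map_nonempty]
  simp only [Finset.map_inj]

theorem configCount_congr (e : X ≃ Y) (κ : Triple) : configCount X κ = configCount Y κ := by
  classical
  refine Finset.card_equiv (Config.congr e) fun x => ?_
  rw [Finset.mem_filter, Finset.mem_filter, congr_mem_configs, type_congr]

theorem connCount_congr (e : X ≃ Y) (κ : Triple) : connCount X κ = connCount Y κ := by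
  classical
  refine Finset.card_equiv (Config.congr e) fun x => ?_
  rw [Finset.mem_filter, Finset.mem_filter, congr_mem_configs, type_congr, isComponent_congr]

theorem connCount_eq_zero {κ : Triple} (h : size κ.1 ≠ Fintype.card X) : connCount X κ = 0 := by
  classical
  rw [connCount, Finset.card_eq_zero, Finset.filter_eq_empty_iff]
  rintro x - ⟨-, rfl⟩
  exact h (size_ptype _)

end Configurations

/-! ### Weighted counts and their recursion -/

/-- The weighted number of configurations of a given type. -/
def configWeight (κ : Triple) : ℚ :=
  (configCount (Fin (size κ.1)) κ : ℚ) / (size κ.1).factorial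

/-- The weighted number of connected configurations of a given type. -/
def connWeight (κ : Triple) : ℚ :=
  (connCount (Fin (size κ.1)) κ : ℚ) / (size κ.1).factorial

/-- Only the cardinality k of `S` matters, and the binomial coefficient n!/(k!(n-k)!) distributes
the normalizing factorials over the two pieces. The type `κ'` forces k = `size κ'.1`. -/
theorem configWeight_recursion (κ : Triple) :
    (size κ.2.1 : ℚ) * configWeight κ =
      ∑ κ' ∈ Finset.Iic κ, size κ'.2.1 * connWeight κ' * configWeight (κ - κ') := by
  set n := size κ.1 with hn
  have h := configCount_recursion (X := Fin n) κ
  have h1 : ∀ S : Finset (Fin n), ∀ κ', connCount {a // a ∈ S} κ' = connCount (Fin S.card) κ' :=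
    fun S κ' => connCount_congr S.equivFin κ'
  have h2 : ∀ S : Finset (Fin n), ∀ κ',
      configCount {a // ¬a ∈ S} κ' = configCount (Fin (n - S.card)) κ' :=
    fun S κ' => configCount_congr (Fintype.equivFinOfCardEq (by
      rw [Fintype.card_subtype_compl, Fintype.card_fin, Fintype.card_coe])) κ'
  simp only [h1, h2] at h
  have h3 := Finset.sum_powerset_apply_card (fun k => ∑ κ' ∈ Finset.Iic κ, size κ'.2.1 *
    connCount (Fin k) κ' * configCount (Fin (n - k)) (κ - κ')) (x := (Finset.univ : Finset (Fin n)))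
  rw [Finset.powerset_univ, Finset.card_univ, Fintype.card_fin] at h3
  rw [h3] at h
  simp only [smul_eq_mul, Finset.mul_sum] at h
  rw [Finset.sum_comm] at h
  have hn0 : (n.factorial : ℚ) ≠ 0 := by positivity
  rw [configWeight, ← hn, ← mul_div_assoc, div_eq_iff hn0]
  have h' := congrArg (Nat.cast : ℕ → ℚ) h
  push_cast at h'
  rw [h', Finset.sum_mul]
  refine Finset.sum_congr rfl fun κ' hκ' => ?_
  have hle : κ' ≤ κ := Finset.mem_Iic.1 hκ'
  have hs : size κ'.1 ≤ n := size_mono hle.1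
  rw [Finset.sum_eq_single (size κ'.1)]
  · have hsub : size (κ - κ').1 = n - size κ'.1 := size_sub hle.1
    rw [configWeight, connWeight, hsub]
    have hc := Nat.choose_mul_factorial_mul_factorial hs
    rw [← hc]
    push_cast
    field_simp
  · intro k _ hk
    rw [connCount_eq_zero (by simpa using hk.symm)]
    simp
  · intro h
    simp at h; omega

open Classical in
-- An empty middle type leaves only τ = 1 with d = ∅, so the count is the size of a conjugacy class,
-- which is n! divided by the order of a centralizer.
theorem configWeight_base (κ : Triple) (h : κ.2.1 = 0) :
    configWeight κ = if κ.1 = κ.2.2 then ((centralizerSize κ.1 : ℚ))⁻¹ else 0 := by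
  obtain ⟨Λ, Δ, Γ⟩ := κ
  simp only at h
  subst h
  have key : ∀ x ∈ configs (Fin (size Λ)), typeOn x.2.1 x.2.2 = 0 → x.2 = (1, ∅) := by
    intro x hx h0
    have hd : x.2.2 = ∅ := by
      rw [← Finset.card_eq_zero, card_domain hx]
      change size (typeOn _ _) = 0
      rw [h0, size_zero]
    refine Prod.ext ?_ hd
    have := mem_configs.1 hx
    rw [hd, Finset.subset_empty] at this
    exact Perm.support_eq_empty_iff.1 this
  have hz : (typeOn (1 : Perm (Fin (size Λ))) ∅) = 0 := by simp [typeOn]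
  simp only [configWeight]
  split_ifs with h
  · subst h
    have e : configCount (Fin (size Λ)) (Λ, 0, Λ) =
        (Finset.univ.filter fun σ : Perm (Fin (size Λ)) => ptype σ = Λ).card := by
      refine Finset.card_bij' (fun x _ => x.1) (fun σ _ => (σ, 1, ∅)) ?_ ?_ ?_ ?_
      · intro x hx
        simp only [Finset.mem_filter, Config.type, Prod.mk.injEq, Finset.mem_univ,
          true_and] at hx ⊢
        exact hx.2.1
      · intro σ hσ
        simp only [Finset.mem_filter, Config.type, Prod.mk.injEq, Finset.mem_univ,
          true_and] at hσ ⊢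
        refine ⟨by simp [mem_configs], hσ, hz, by rw [mul_one, hσ]⟩
      · intro x hx
        simp only [Finset.mem_filter, Config.type, Prod.mk.injEq] at hx
        exact Prod.ext rfl (key x hx.1 hx.2.2.1).symm
      · intro σ _
        rfl
    have hc := card_ptype (X := Fin (size Λ)) Λ (by simp)
    have hp : (centralizerSize Λ : ℚ) ≠ 0 := by exact_mod_cast (centralizerSize_pos Λ).ne'
    rw [Fintype.card_fin] at hc
    rw [e, ← hc]
    have : (((Finset.univ.filter fun σ : Perm (Fin (size Λ)) => ptype σ = Λ).card : ℕ) : ℚ) ≠ 0 := by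
      intro h0
      rw [Nat.cast_eq_zero] at h0
      rw [h0, zero_mul] at hc
      exact (Nat.factorial_pos _).ne hc
    push_cast
    field_simp
  · rw [div_eq_zero_iff]; left
    rw [Nat.cast_eq_zero, configCount, Finset.card_eq_zero, Finset.filter_eq_empty_iff]
    intro x hx hx'
    simp only [Config.type, Prod.mk.injEq] at hx'
    have := key x hx hx'.2.1
    rw [this] at hx'
    simp only [mul_one] at hx'
    exact h (hx'.1.symm.trans hx'.2.2)

/-! ### Sums over families of triples -/

theorem autCard_erase {T : Multiset Triple} {t : Triple} (ht : t ∈ T) :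
    autCard T = T.count t * autCard (T.erase t) := by
  have h1 : autCard (T.erase t) = ∏ s ∈ T.toFinset, ((T.erase t).count s).factorial := by
    refine Finset.prod_subset (fun s hs => ?_) fun s _ hs => ?_
    · rw [Multiset.mem_toFinset] at *
      exact Multiset.mem_of_mem_erase hs
    · rw [Multiset.mem_toFinset] at hs
      rw [Multiset.count_eq_zero_of_notMem hs]; rfl
  have hmem : t ∈ T.toFinset := Multiset.mem_toFinset.2 ht
  rw [h1, autCard, ← Finset.mul_prod_erase _ _ hmem, ← Finset.mul_prod_erase _ _ hmem,
    ← mul_assoc]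
  congr 1
  · rw [Multiset.count_erase_self]
    exact (Nat.mul_factorial_pred (Multiset.count_pos.2 ht).ne').symm
  · refine Finset.prod_congr rfl fun s hs => ?_
    rw [Multiset.count_erase_of_ne (Finset.ne_of_mem_erase hs)]

theorem autCard_pos (T : Multiset Triple) : 0 < autCard T :=
  Finset.prod_pos fun _ _ => Nat.factorial_pos _

/-- The product of the weights of the members of a family, over the number of automorphisms. -/
def familyWeight (c : Triple → ℚ) (T : Multiset Triple) : ℚ := (T.map c).prod / autCard T

/-- The termwise form of the rule for differentiating an exponential: the multiplicity cancels one
factor of the automorphism number. -/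
theorem count_mul_familyWeight (c : Triple → ℚ) {T : Multiset Triple} {t : Triple} (ht : t ∈ T) :
    (T.count t : ℚ) * familyWeight c T = c t * familyWeight c (T.erase t) := by
  have h0 : (T.count t : ℚ) ≠ 0 := by exact_mod_cast (Multiset.count_pos.2 ht).ne'
  have h1 : (autCard (T.erase t) : ℚ) ≠ 0 := by exact_mod_cast (autCard_pos _).ne'
  rw [familyWeight, familyWeight, autCard_erase ht, ← Multiset.prod_map_erase ht]
  push_cast
  field_simp

/-- The size of the middle partition. -/
def midSize : Triple →+ ℕ :=
  sizeHom.comp ((AddMonoidHom.fst Ptn Ptn).comp (AddMonoidHom.snd Ptn (Ptn × Ptn)))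

@[simp] theorem midSize_apply (κ : Triple) : midSize κ = size κ.2.1 := rfl

theorem midSize_multiset_sum (T : Multiset Triple) :
    midSize T.sum = (T.map midSize).sum := map_multiset_sum midSize T

theorem midSize_mono {κ κ' : Triple} (h : κ ≤ κ') : midSize κ ≤ midSize κ' := size_mono h.2.1

/-- The families of triples with nonempty middle partitions and with sum at most `κ`. -/
def familiesBelow (κ : Triple) : Set (Multiset Triple) :=
  {T | T.sum ≤ κ ∧ ∀ t ∈ T, 1 ≤ midSize t}

theorem card_le_midSize {T : Multiset Triple} (h : ∀ t ∈ T, 1 ≤ midSize t) :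
    Multiset.card T ≤ midSize T.sum := by
  rw [midSize_multiset_sum, ← Multiset.card_map midSize T]
  simpa using Multiset.card_nsmul_le_sum (s := T.map midSize) (a := 1) fun x hx => by
    obtain ⟨t, ht, rfl⟩ := Multiset.mem_map.1 hx
    exact h t ht

theorem finite_families (K : ℕ) {s : Set Triple} (hs : s.Finite) :
    {T : Multiset Triple | Multiset.card T ≤ K ∧ ∀ t ∈ T, t ∈ s}.Finite := by
  -- No element occurs more than `K` times, so all these families are contained in `K` copies of
  -- `s`.
  refine (Multiset.powerset (K • hs.toFinset.val)).toFinset.finite_toSet.subset fun T hT => ?_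
  rw [Finset.mem_coe, Multiset.mem_toFinset, Multiset.mem_powerset, Multiset.le_iff_count]
  intro t
  by_cases ht : t ∈ T
  · rw [Multiset.count_nsmul, Multiset.count_eq_one_of_mem hs.toFinset.nodup
      (by simpa using hT.2 t ht), mul_one]
    exact (Multiset.count_le_card _ _).trans hT.1
  · rw [Multiset.count_eq_zero_of_notMem ht]; exact Nat.zero_le _

theorem le_sum_of_mem {T : Multiset Triple} {t : Triple} (ht : t ∈ T) : t ≤ T.sum := by
  rw [← Multiset.cons_erase ht, Multiset.sum_cons]
  exact le_self_add

theorem finite_familiesBelow (κ : Triple) : (familiesBelow κ).Finite :=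
  (finite_families (midSize κ) (Set.finite_Iic κ)).subset fun _ hT =>
    ⟨(card_le_midSize hT.2).trans (midSize_mono hT.1),
      fun _ ht => (le_sum_of_mem ht).trans hT.1⟩

/-- The sum over families of triples which sum up to `κ` together with a remainder. -/
def familySum (c b : Triple → ℚ) (κ : Triple) : ℚ :=
  ∑ T ∈ (finite_familiesBelow κ).toFinset, familyWeight c T * b (κ - T.sum)

/-- By `hb` the remainder carries no middle size, so the middle size of `κ` is distributed over the
members of the family. Singling out a member `t` and erasing it is inverse to adjoining it. -/
theorem familySum_recursion (c b : Triple → ℚ) (hb : ∀ κ, midSize κ ≠ 0 → b κ = 0) (κ : Triple) :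
    (midSize κ : ℚ) * familySum c b κ =
      ∑ t ∈ Finset.Iic κ, midSize t * c t * familySum c b (κ - t) := by
  have hL : (midSize κ : ℚ) * familySum c b κ =
      ∑ T ∈ (finite_familiesBelow κ).toFinset, ∑ t ∈ T.toFinset,
        midSize t * c t * (familyWeight c (T.erase t) * b (κ - T.sum)) := by
    rw [familySum, Finset.mul_sum]
    refine Finset.sum_congr rfl fun T hT => ?_
    rw [Set.Finite.mem_toFinset] at hT
    by_cases h0 : b (κ - T.sum) = 0
    · simp [h0]
    · have h1 : midSize (κ - T.sum) = 0 := by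
        by_contra h; exact h0 (hb _ h)
      have h2 : midSize κ = ∑ t ∈ T.toFinset, T.count t * midSize t := by
        rw [← tsub_add_cancel_of_le hT.1, map_add, h1, zero_add, midSize_multiset_sum,
          Finset.sum_multiset_map_count]
        rfl
      rw [h2]
      push_cast
      rw [Finset.sum_mul]
      refine Finset.sum_congr rfl fun t ht => ?_
      have := count_mul_familyWeight c (Multiset.mem_toFinset.1 ht)
      linear_combination (midSize t : ℚ) * b (κ - T.sum) * this
  have hR : ∑ t ∈ Finset.Iic κ, (midSize t : ℚ) * c t * familySum c b (κ - t) =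
      ∑ t ∈ (Finset.Iic κ).filter (1 ≤ midSize ·), midSize t * c t * familySum c b (κ - t) := by
    symm
    refine Finset.sum_filter_of_ne fun t _ h => ?_
    by_contra h0
    have : midSize t = 0 := by omega
    simp [this] at h
  rw [hL, hR]
  simp only [familySum, Finset.mul_sum]
  rw [Finset.sum_sigma', Finset.sum_sigma']
  refine Finset.sum_bij' (fun p _ => ⟨p.2, p.1.erase p.2⟩) (fun p _ => ⟨p.1 ::ₘ p.2, p.1⟩)
    ?_ ?_ ?_ ?_ ?_
  · rintro ⟨T, t⟩ h
    simp only [Finset.mem_sigma, Set.Finite.mem_toFinset, Multiset.mem_toFinset,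
      Finset.mem_filter, Finset.mem_Iic] at h ⊢
    obtain ⟨⟨hT, hpos⟩, ht⟩ := h
    refine ⟨⟨(le_sum_of_mem ht).trans hT, hpos t ht⟩, ?_,
      fun s hs => hpos s (Multiset.mem_of_mem_erase hs)⟩
    rw [← Multiset.cons_erase ht, Multiset.sum_cons] at hT
    rw [add_comm] at hT
    exact le_tsub_of_add_le_right hT
  · rintro ⟨t, T⟩ h
    simp only [Finset.mem_sigma, Set.Finite.mem_toFinset, Multiset.mem_toFinset,
      Finset.mem_filter, Finset.mem_Iic] at h ⊢
    obtain ⟨⟨ht, hpos⟩, hT, hpos'⟩ := h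
    refine ⟨⟨?_, fun s hs => ?_⟩, Multiset.mem_cons_self _ _⟩
    · rw [Multiset.sum_cons, add_comm]
      exact (add_le_add_left hT t).trans (tsub_add_cancel_of_le ht).le
    · rcases Multiset.mem_cons.1 hs with rfl | hs
      exacts [hpos, hpos' s hs]
  · rintro ⟨T, t⟩ h
    simp only [Finset.mem_sigma, Multiset.mem_toFinset] at h
    simp only [Multiset.cons_erase h.2]
  · rintro ⟨t, T⟩ _
    simp
  · rintro ⟨T, t⟩ h
    simp only [Finset.mem_sigma, Multiset.mem_toFinset] at h
    have : κ - T.sum = κ - t - (T.erase t).sum := by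
      rw [tsub_tsub, ← Multiset.sum_cons, Multiset.cons_erase h.2]
    rw [this]

/-- The recursion determines `D` by induction on the middle size: terms with `midSize t = 0` vanish,
and the others refer to smaller arguments. At middle size 0 the only family is the empty one. -/
theorem eq_familySum (c b D : Triple → ℚ) (hb : ∀ κ, midSize κ ≠ 0 → b κ = 0)
    (hD : ∀ κ, (midSize κ : ℚ) * D κ = ∑ t ∈ Finset.Iic κ, midSize t * c t * D (κ - t))
    (h0 : ∀ κ, midSize κ = 0 → D κ = b κ) (κ : Triple) : D κ = familySum c b κ := by
  induction hn : midSize κ using Nat.strong_induction_on generalizing κ with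
  | _ n ih =>
  rcases Nat.eq_zero_or_pos n with rfl | hpos
  · rw [h0 κ hn, familySum, Finset.sum_eq_single 0]
    · simp [familyWeight, autCard]
    · intro T hT hne
      rw [Set.Finite.mem_toFinset] at hT
      have := (card_le_midSize hT.2).trans (midSize_mono hT.1)
      rw [hn] at this
      exact absurd (Multiset.card_eq_zero.1 (by omega)) hne
    · intro h
      exact absurd ((Set.Finite.mem_toFinset (finite_familiesBelow κ)).2
        (show (0 : Multiset Triple) ∈ familiesBelow κ from ⟨zero_le, by simp⟩)) h
  · have hne : (midSize κ : ℚ) ≠ 0 := by rw [hn]; exact_mod_cast hpos.ne'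
    refine mul_left_cancel₀ hne ?_
    rw [hD, familySum_recursion c b hb]
    refine Finset.sum_congr rfl fun t ht => ?_
    rw [Finset.mem_Iic] at ht
    rcases Nat.eq_zero_or_pos (midSize t) with h | h
    · simp [h]
    · have : midSize (κ - t) + midSize t = n := by
        rw [← map_add, tsub_add_cancel_of_le ht, hn]
      rw [ih (midSize (κ - t)) (by omega) _ rfl]

open Classical in
/-- The weight of the configurations `(σ, 1, ∅)`. -/
def trivialWeight (κ : Triple) : ℚ :=
  if κ.2.1 = 0 ∧ κ.1 = κ.2.2 then ((centralizerSize κ.1 : ℚ))⁻¹ else 0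

theorem configWeight_eq_familySum (κ : Triple) :
    configWeight κ = familySum connWeight trivialWeight κ := by
  refine eq_familySum _ _ _ ?_ configWeight_recursion ?_ κ
  · intro κ h
    rw [trivialWeight, if_neg]
    rintro ⟨h', -⟩
    exact h (by rw [midSize_apply, h', size_zero])
  · intro κ h
    have h' : κ.2.1 = 0 := eq_zero_of_size_eq_zero h
    rw [configWeight_base κ h', trivialWeight]
    simp [h']

/-! ### Monodromy data -/

theorem HasShiftedType.sign {n : ℕ} {Δ : Ptn} {f : Perm (Fin n)} (h : HasShiftedType Δ f) :
    Perm.sign f = ((size Δ : ℤ) - len Δ).negOnePow := by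
  obtain ⟨-, h⟩ := hasShiftedType_iff.1 h
  have h1 : size Δ = f.cycleType.sum + Δ 1 := by
    conv_lhs => rw [h, size_add, size_ofParts (cycleType_pos f), size_single]
    simp
  have h2 : len Δ = Multiset.card f.cycleType + Δ 1 := by
    conv_lhs => rw [h, len_add, len_ofParts (cycleType_pos f), len_single]
  rw [Perm.sign_of_cycleType, h1, h2, Nat.cast_add, Nat.cast_add, add_sub_add_right_eq_sub,
    Int.negOnePow_sub, Int.negOnePow_def, Int.negOnePow_def, zpow_natCast, zpow_natCast, pow_add]

theorem negOnePow_list_sum (l : List ℤ) : l.sum.negOnePow = (l.map Int.negOnePow).prod := by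
  induction l with
  | nil => simp
  | cons a l ih => simp [Int.negOnePow_add, ih]

/-- Commutators are even and sᵢ has sign (-1)^{|Δᵢ|-l(Δᵢ)}. Hence wherever monodromy data exist, the
Riemann–Hurwitz formula has an integral solution, and the case distinction in the Hurwitz numbers
costs nothing. -/
theorem even_totalColength {g n : ℕ} {L : List Ptn}
    {x : (Fin g → Perm (Fin n) × Perm (Fin n)) × (Fin L.length → Perm (Fin n))}
    (hx : x ∈ monodromies g n L) : Even (totalColength L) := by
  obtain ⟨ht, hp⟩ := hx
  rw [← Int.negOnePow_eq_one_iff, totalColength, negOnePow_list_sum, List.map_map]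
  have h := congrArg Perm.sign hp
  rw [map_mul, map_list_prod, map_list_prod, List.map_ofFn, List.map_ofFn, map_one] at h
  have h1 : (List.ofFn (⇑Perm.sign ∘ fun j =>
      (x.1 j).1 * (x.1 j).2 * (x.1 j).1⁻¹ * (x.1 j).2⁻¹)).prod = 1 := by
    refine List.prod_eq_one fun s hs => ?_
    obtain ⟨j, rfl⟩ := (List.mem_ofFn' _ _).1 hs
    simp only [Function.comp_apply, map_mul, map_inv, Int.units_inv_eq_self]
    rw [mul_right_comm (Perm.sign (x.1 j).1), mul_assoc, Int.units_mul_self, Int.units_mul_self,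
      one_mul]
  rw [h1, one_mul] at h
  rw [← h]
  congr 1
  conv_lhs => rw [← List.ofFn_get L]
  rw [List.map_ofFn]
  congr 1
  funext i
  exact (ht i).sign.symm

theorem riemannHurwitz_of_even (g n : ℕ) {L : List Ptn} (h : Even (totalColength L)) :
    RiemannHurwitz g (sourceGenus g n L) n L := by
  obtain ⟨k, hk⟩ := h
  unfold RiemannHurwitz sourceGenus
  have : (2 * (g : ℤ) - 2) * n + totalColength L = 2 * (((g : ℤ) - 1) * n + k) := by
    rw [hk]; ring
  rw [this, Int.mul_ediv_cancel_left _ two_ne_zero, hk]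
  ring

theorem two_mul_sourceGenus (g n : ℕ) {L : List Ptn} (h : Even (totalColength L)) :
    2 * sourceGenus g n L - 2 = (2 * (g : ℤ) - 2) * n + totalColength L := by
  have := riemannHurwitz_of_even g n h
  unfold RiemannHurwitz at this
  linarith

theorem hasShiftedType_iff_ptype {n : ℕ} {Δ : Ptn} {f : Perm (Fin n)} (h : size Δ = n) :
    HasShiftedType Δ f ↔ ptype f = Δ := by
  rw [hasShiftedType_iff]
  constructor
  · rintro ⟨-, h'⟩
    have h1 : size Δ = f.support.card + Δ 1 := by
      conv_lhs => rw [h', size_add, size_ofParts_cycleType]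
      simp
    rw [ptype, typeOn, Finset.card_univ, Fintype.card_fin, show n - f.support.card = Δ 1 by omega,
      ← h']
  · rintro rfl
    refine ⟨h.le, ?_⟩
    rw [ptype, typeOn_apply_one]; rfl

theorem perm_apply_inv {X : Type*} (f : Perm X) (a : X) : f (f⁻¹ a) = a := f.apply_symm_apply a

theorem isPretransitive_closure_iff {X : Type*} [Fintype X] [DecidableEq X] (s : Set (Perm X)) :
    MulAction.IsPretransitive (Subgroup.closure s) X ↔
      ∀ S : Finset X, (∀ f ∈ s, ∀ a, f a ∈ S ↔ a ∈ S) → S.Nonempty → S = Finset.univ := by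
  constructor
  · intro h S hS ⟨a, ha⟩
    have hcl : ∀ f ∈ Subgroup.closure s, ∀ b, f b ∈ S ↔ b ∈ S := by
      intro f hf
      induction hf using Subgroup.closure_induction with
      | mem f hf => exact hS f hf
      | one => exact fun b => Iff.rfl
      | mul f g _ _ hf hg => exact fun b => (hf _).trans (hg b)
      | inv f _ hf => exact fun b => by rw [← hf, perm_apply_inv]
    refine Finset.eq_univ_of_forall fun b => ?_
    obtain ⟨f, hf⟩ := h.exists_smul_eq a b
    rw [← hf]
    exact (hcl f f.2 a).2 ha
  · intro h
    classical
    refine ⟨fun a b => ?_⟩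
    let S : Finset X := Finset.univ.filter (· ∈ MulAction.orbit (Subgroup.closure s) a)
    have hS : S = Finset.univ := by
      refine h S (fun f hf c => ?_) ⟨a, by simp [S]⟩
      simp only [S, Finset.mem_filter, Finset.mem_univ, true_and]
      let F : Subgroup.closure s := ⟨f, Subgroup.subset_closure hf⟩
      constructor
      · rintro ⟨g, hg⟩
        refine ⟨F⁻¹ * g, ?_⟩
        simp only [mul_smul]
        exact inv_smul_eq_iff.2 hg
      · rintro ⟨g, hg⟩
        refine ⟨F * g, ?_⟩
        simp only [mul_smul]
        exact congrArg f hg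
    have := Finset.mem_univ b
    rw [← hS] at this
    exact (Finset.mem_filter.1 this).2

theorem isComponent_univ_iff {n : ℕ} (x : Config (Fin n)) :
    IsComponent x Finset.univ ↔ 0 < n ∧
      ∀ S : Finset (Fin n), IsInvariant x S → S.Nonempty → S = Finset.univ := by
  constructor
  · rintro ⟨-, ⟨a, -⟩, h⟩
    exact ⟨a.pos, fun S => h S (Finset.subset_univ S)⟩
  · rintro ⟨hn, h⟩
    exact ⟨fun a => by simp, ⟨⟨0, hn⟩, Finset.mem_univ _⟩, fun S _ => h S⟩

/-- The third permutation is the inverse of the product of the first two, so it preserves every set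
that these preserve. The number `r` is kept variable to allow for the length of a list. -/
theorem isConnectedData_iff {n r : ℕ} (a : Fin 0 → Perm (Fin n) × Perm (Fin n))
    (s : Fin r → Perm (Fin n)) (hr : r = 3) (h : s ⟨0, by omega⟩ * s ⟨1, by omega⟩ * s ⟨2, by omega⟩ = 1)
    (d : Finset (Fin n)) :
    IsConnectedData (a, s) ↔ IsComponent (s ⟨0, by omega⟩, s ⟨1, by omega⟩, d) Finset.univ := by
  subst hr
  rw [isComponent_univ_iff, IsConnectedData, isPretransitive_closure_iff]
  refine and_congr_right fun _ => forall_congr' fun S => imp_congr_left ?_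
  have h2 : s ⟨2, by omega⟩ = (s ⟨0, by omega⟩ * s ⟨1, by omega⟩)⁻¹ := (inv_eq_of_mul_eq_one_right h).symm
  constructor
  · intro hS b
    exact ⟨hS _ (Or.inr ⟨_, rfl⟩) b, hS _ (Or.inr ⟨_, rfl⟩) b⟩
  · rintro hS f ((⟨i, -⟩ | ⟨i, -⟩) | ⟨i, rfl⟩) b
    · exact i.elim0
    · exact i.elim0
    · fin_cases i
      · exact (hS b).1
      · exact (hS b).2
      · change s ⟨2, by omega⟩ b ∈ S ↔ _
        -- With c = (s₀ s₁)⁻¹ b, membership passes from c to s₁ c and on to s₀ (s₁ c) = b.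
        rw [h2, ← (hS (((s ⟨0, by omega⟩ * s ⟨1, by omega⟩)⁻¹) b)).2, ← (hS _).1]
        change (s ⟨0, by omega⟩ * s ⟨1, by omega⟩) _ ∈ S ↔ _
        rw [perm_apply_inv]

/-- The monodromy data of coverings of the sphere with three branch points. -/
def sphereMonodromyEquiv {n : ℕ} (Γ' Δ Γ : Ptn) :
    {x : monodromies 0 n [Γ', Δ, Γ] // IsConnectedData x.1} ≃
      {p : Perm (Fin n) × Perm (Fin n) // HasShiftedType Γ' p.1 ∧ HasShiftedType Δ p.2 ∧
        HasShiftedType Γ (p.1 * p.2)⁻¹ ∧ IsComponent (p.1, p.2, ∅) Finset.univ} where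
  toFun x := ⟨(x.1.1.2 (0 : Fin 3), x.1.1.2 (1 : Fin 3)), by
    obtain ⟨⟨⟨a, s⟩, ht, hp⟩, hc⟩ := x
    have hp' : s (0 : Fin 3) * s (1 : Fin 3) * s (2 : Fin 3) = 1 := by
      simpa [mul_assoc] using hp
    have h2 : (s (0 : Fin 3) * s (1 : Fin 3))⁻¹ = s (2 : Fin 3) := inv_eq_of_mul_eq_one_right hp'
    refine ⟨ht (0 : Fin 3), ht (1 : Fin 3), ?_, (isConnectedData_iff a s rfl hp' ∅).1 hc⟩
    rw [h2]
    exact ht (2 : Fin 3)⟩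
  invFun p := ⟨⟨(Fin.elim0, ![p.1.1, p.1.2, (p.1.1 * p.1.2)⁻¹]), by
    refine ⟨fun i => ?_, by simp⟩
    change Fin 3 at i
    fin_cases i
    exacts [p.2.1, p.2.2.1, p.2.2.2.1]⟩,
    (isConnectedData_iff Fin.elim0 ![p.1.1, p.1.2, (p.1.1 * p.1.2)⁻¹] rfl
      (mul_inv_cancel _) ∅).2 p.2.2.2.2⟩
  left_inv x := by
    obtain ⟨⟨⟨a, s⟩, ht, hp⟩, hc⟩ := x
    have hp' : s (0 : Fin 3) * s (1 : Fin 3) * s (2 : Fin 3) = 1 := by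
      simpa [mul_assoc] using hp
    have h2 : (s (0 : Fin 3) * s (1 : Fin 3))⁻¹ = s (2 : Fin 3) := inv_eq_of_mul_eq_one_right hp'
    refine Subtype.ext (Subtype.ext (Prod.ext (Subsingleton.elim _ _) (funext fun i => ?_)))
    change Fin 3 at i
    fin_cases i
    exacts [rfl, rfl, h2]
  right_inv p := rfl

open Classical in
-- Connectedness does not involve the domain, so each monodromy datum gives rise to as many
-- configurations as its middle permutation has domains. The third permutation (στ)⁻¹ has the same
-- type as στ.
theorem connCount_eq {n : ℕ} {κ : Triple} (h1 : size κ.1 = n) (h2 : size κ.2.2 = n) :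
    connCount (Fin n) κ = (n - size κ.2.1 + κ.2.1 1).choose (κ.2.1 1) *
      Nat.card {x : monodromies 0 n [κ.1, κ.2.1, κ.2.2] // IsConnectedData x.1} := by
  have hind : ∀ (σ τ : Perm (Fin n)) (d : Finset (Fin n)),
      IsComponent (σ, τ, d) Finset.univ ↔ IsComponent (σ, τ, ∅) Finset.univ :=
    fun _ _ _ => Iff.rfl
  rw [Nat.card_congr (sphereMonodromyEquiv κ.1 κ.2.1 κ.2.2), Nat.card_eq_fintype_card,
    Fintype.card_subtype, connCount, configs, Finset.filter_filter, Finset.card_filter,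
    Finset.card_filter, ← Finset.univ_product_univ, Finset.sum_product,
    ← Finset.univ_product_univ, ← Finset.univ_product_univ, Finset.sum_product, Finset.mul_sum]
  refine Finset.sum_congr rfl fun σ _ => ?_
  rw [Finset.sum_product, Finset.mul_sum]
  refine Finset.sum_congr rfl fun τ _ => ?_
  have hd := card_domains κ.2.1 τ
  rw [Finset.card_filter] at hd
  simp only [hasShiftedType_iff_ptype h1, hasShiftedType_iff_ptype h2, ptype_inv]
  by_cases hP : ptype σ = κ.1 ∧ ptype (σ * τ) = κ.2.2 ∧ IsComponent (σ, τ, ∅) Finset.univ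
  · obtain ⟨hP1, hP2, hP3⟩ := hP
    rw [hP1, hP2]
    simp only [hP3, true_and, and_true]
    rw [mul_ite, mul_one, mul_zero, ← hd]
    refine Finset.sum_congr rfl fun d _ => ?_
    simp only [hind σ τ d, hP3, true_and, Config.type, hP1, hP2, Prod.ext_iff, and_true]
  · rw [if_neg (by tauto), mul_zero, Finset.sum_eq_zero]
    intro d _
    rw [if_neg]
    rintro ⟨-, hc, hκ⟩
    refine hP ⟨?_, ?_, (hind σ τ d).1 hc⟩ <;> rw [← hκ] <;> rfl

/-- The outer profiles have full size, so their shift factors are binom(m₁, m₁) = 1, and the factor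
of the middle one counts domains. If the sizes differ or the Riemann–Hurwitz formula fails, there is
nothing to count. -/
theorem tripleWeight_eq (κ : Triple) : tripleWeight κ = partsProd κ.1 * connWeight κ := by
  classical
  unfold tripleWeight
  split_ifs with h
  · congr 1
    rw [connShiftedHurwitz, connHurwitz, connWeight, connCount_eq rfl h]
    have hs : shiftFactor (size κ.1) [κ.1, κ.2.1, κ.2.2] =
        ((size κ.1 - size κ.2.1 + κ.2.1 1).choose (κ.2.1 1) : ℕ) := by
      simp [shiftFactor, h]
    rw [hs]
    split_ifs with hRH
    · push_cast; ring
    · have : IsEmpty {x : monodromies 0 (size κ.1) [κ.1, κ.2.1, κ.2.2] //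
          IsConnectedData x.1} :=
        ⟨fun x => hRH (riemannHurwitz_of_even _ _ (even_totalColength x.1.2))⟩
      simp
  · rw [connWeight, connCount, Finset.filter_eq_empty_iff.2]
    · simp
    · rintro x - ⟨-, hx⟩
      refine h ?_
      have : κ.2.2 = ptype (x.1 * x.2.1) := congrArg (fun κ : Triple => κ.2.2) hx.symm
      rw [this, size_ptype, Fintype.card_fin]

theorem size_eq_of_tripleWeight_ne_zero {κ : Triple} (h : tripleWeight κ ≠ 0) :
    size κ.2.2 = size κ.1 := by
  by_contra hne
  exact h (if_neg hne)

/-- In a connected configuration, all the fixed points of `σ τ` belong to the domain of `τ`. -/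
theorem fixed_le_of_tripleWeight_ne_zero {κ : Triple} (h : tripleWeight κ ≠ 0)
    (hpos : 1 ≤ size κ.2.1) : κ.2.2 1 ≤ size κ.2.1 := by
  classical
  rw [tripleWeight_eq] at h
  have hc : connCount (Fin (size κ.1)) κ ≠ 0 := by
    intro h0
    simp [connWeight, h0] at h
  obtain ⟨⟨σ, τ, d⟩, hx⟩ := Finset.card_ne_zero.1 hc
  rw [Finset.mem_filter] at hx
  obtain ⟨hx, hconn, hκ⟩ := hx
  have e1 : κ.2.2 = ptype (σ * τ) := congrArg (fun κ : Triple => κ.2.2) hκ.symm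
  have e2 : size κ.2.1 = d.card :=
    (congrArg (fun κ : Triple => size κ.2.1) hκ.symm).trans (card_domain hx).symm
  rw [e1, ptype, typeOn_apply_one, e2, Finset.card_univ, ← Finset.card_compl]
  refine Finset.card_le_card fun a ha => ?_
  -- A fixed point of στ outside `d` is fixed by τ, hence also by σ, and is an orbit by itself. By
  -- connectedness it is the only point, which contradicts that `d` is nonempty.
  by_contra had
  have hτ : τ a = a := by
    by_contra hne
    exact had (mem_configs.1 hx (Perm.mem_support.2 hne))
  have hσ : σ a = a := by simpa [hτ] using ha
  have hinv : IsInvariant (σ, τ, d) {a} := fun b => by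
    simp only [Finset.mem_singleton]
    refine ⟨?_, ?_⟩
    · conv_lhs => rw [← hσ]
      exact σ.injective.eq_iff
    · conv_lhs => rw [← hτ]
      exact τ.injective.eq_iff
  have huniv := hconn.2.2 _ (Finset.subset_univ _) hinv ⟨a, by simp⟩
  obtain ⟨b, hb⟩ := Finset.card_pos.1 (e2 ▸ hpos)
  have : b ∈ ({a} : Finset _) := huniv ▸ Finset.mem_univ b
  rw [Finset.mem_singleton] at this
  exact had (this ▸ hb)

/-! ### Formal series and finitary operators -/

theorem Series.ext_coeff {F G : Series} (h : ∀ e M, F.coeff e M = G.coeff e M) : F = G :=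
  funext fun e => MvPowerSeries.ext fun M => h e M

theorem coeff_formalSum {ι : Type*} (f : ι → Series) (e : ℤ) (M : Var →₀ ℕ) :
    (formalSum f).coeff e M = ∑ᶠ i, (f i).coeff e M := rfl

theorem formalSum_prod {ι κ : Type*} {f : ι × κ → Series} (hf : FormallySummable f) :
    formalSum f = formalSum fun i => formalSum fun k => f (i, k) :=
  Series.ext_coeff fun e M => by
    simp only [coeff_formalSum]
    exact finsum_curry _ (hf e M)

theorem formalSum_comp_equiv {ι κ : Type*} (e : κ ≃ ι) (f : ι → Series) :
    formalSum (fun k => f (e k)) = formalSum f :=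
  Series.ext_coeff fun i M => by
    simp only [coeff_formalSum]
    exact finsum_comp_equiv e (f := fun k => (f k).coeff i M)

theorem FormallySummable.comp_injective {ι κ : Type*} {f : ι → Series} (hf : FormallySummable f)
    {g : κ → ι} (hg : Function.Injective g) : FormallySummable fun k => f (g k) :=
  fun e M => (hf e M).preimage hg.injOn

theorem coeff_sum {ι : Type*} (s : Finset ι) (f : ι → Series) (e : ℤ) (M : Var →₀ ℕ) :
    (∑ i ∈ s, f i).coeff e M = ∑ i ∈ s, (f i).coeff e M := by
  simp [Series.coeff]

theorem coeff_smul (a : ℚ) (F : Series) (e : ℤ) (M : Var →₀ ℕ) :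
    (a • F).coeff e M = a * F.coeff e M := by
  simp [Series.coeff]

theorem formalSum_eq_sum {ι : Type*} {f : ι → Series} (s : Finset ι) (h : ∀ i ∉ s, f i = 0) :
    formalSum f = ∑ i ∈ s, f i :=
  Series.ext_coeff fun e M => by
    rw [coeff_sum, coeff_formalSum]
    refine finsum_eq_sum_of_support_subset _ fun i hi => ?_
    by_contra hs
    exact hi (by simp [h i hs, Series.coeff])

/-- The finite linear combinations of the coefficients of a power series. -/
def coeffSpan : Submodule ℚ (PS → ℚ) :=
  Submodule.span ℚ (Set.range fun (M : Var →₀ ℕ) (P : PS) => MvPowerSeries.coeff M P)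

/-- Each coefficient of `f P` is a finite linear combination of coefficients of `P`. -/
def FinitaryPS (f : PS → PS) : Prop := ∀ M, (fun P => MvPowerSeries.coeff M (f P)) ∈ coeffSpan

/-- The finite linear combinations of the coefficients of a series. -/
def seriesSpan : Submodule ℚ (Series → ℚ) :=
  Submodule.span ℚ (Set.range fun (k : ℤ × (Var →₀ ℕ)) (F : Series) => F.coeff k.1 k.2)

/-- Each coefficient of `D F` is a finite linear combination of coefficients of `F`. -/
def Finitary (D : Series → Series) : Prop := ∀ e M, (fun F => (D F).coeff e M) ∈ seriesSpan

theorem coeff_mem_coeffSpan (M : Var →₀ ℕ) :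
    (fun P : PS => MvPowerSeries.coeff M P) ∈ coeffSpan :=
  Submodule.subset_span ⟨M, rfl⟩

theorem FinitaryPS.comp_mem {f : PS → PS} (hf : FinitaryPS f) {φ : PS → ℚ} (hφ : φ ∈ coeffSpan) :
    (fun P => φ (f P)) ∈ coeffSpan := by
  induction hφ using Submodule.span_induction with
  | mem φ h => obtain ⟨M, rfl⟩ := h; exact hf M
  | zero => exact coeffSpan.zero_mem
  | add φ ψ _ _ h1 h2 => exact coeffSpan.add_mem h1 h2
  | smul a φ _ h => exact coeffSpan.smul_mem a h

theorem FinitaryPS.comp {f g : PS → PS} (hf : FinitaryPS f) (hg : FinitaryPS g) :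
    FinitaryPS (fun P => f (g P)) := fun M => hg.comp_mem (hf M)

theorem finitaryPS_id : FinitaryPS fun P => P := coeff_mem_coeffSpan

theorem FinitaryPS.iterate {f : PS → PS} (hf : FinitaryPS f) (k : ℕ) : FinitaryPS f^[k] := by
  induction k with
  | zero => exact finitaryPS_id
  | succ k ih =>
    rw [Function.iterate_succ']
    exact hf.comp ih

theorem finitaryPS_mul_left (Q : PS) : FinitaryPS fun P => Q * P := fun M => by
  classical
  have : (fun P : PS => MvPowerSeries.coeff M (Q * P)) =
      ∑ p ∈ Finset.HasAntidiagonal.antidiagonal M, MvPowerSeries.coeff p.1 Q •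
        fun P : PS => MvPowerSeries.coeff p.2 P := by
    funext P
    rw [MvPowerSeries.coeff_mul]
    simp
  rw [this]
  exact coeffSpan.sum_mem fun p _ => coeffSpan.smul_mem _ (coeff_mem_coeffSpan _)

theorem FinitaryPS.smul {f : PS → PS} (hf : FinitaryPS f) (a : ℚ) :
    FinitaryPS fun P => a • f P := fun M => by
  have : (fun P : PS => MvPowerSeries.coeff M (a • f P)) =
      a • fun P : PS => MvPowerSeries.coeff M (f P) := by
    funext P; simp
  rw [this]
  exact coeffSpan.smul_mem _ (hf M)

theorem finitaryPS_pderiv (i : Var) : FinitaryPS fun P => MvPowerSeries.pderiv ℚ i P := fun M => by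
  have : (fun P : PS => MvPowerSeries.coeff M (MvPowerSeries.pderiv ℚ i P)) =
      ((M i : ℚ) + 1) • fun P : PS => MvPowerSeries.coeff (M + Finsupp.single i 1) P := by
    funext P
    rw [MvPowerSeries.coeff_pderiv]
    simp [mul_comm]
  rw [this]
  exact coeffSpan.smul_mem _ (coeff_mem_coeffSpan _)

theorem finitaryPS_ptnDeriv (Γ : Ptn) : FinitaryPS (ptnDeriv Γ) := by
  unfold ptnDeriv
  generalize Γ.support.sort (· ≤ ·) = l
  induction l with
  | nil => exact finitaryPS_id
  | cons a l ih => exact ((finitaryPS_pderiv (pIdx a)).iterate (Γ a)).comp ih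

theorem FinitaryPS.mem_seriesSpan {f : PS → PS} (hf : FinitaryPS f) (e : ℤ) (M : Var →₀ ℕ) :
    (fun F : Series => MvPowerSeries.coeff M (f (F e))) ∈ seriesSpan := by
  have : ∀ φ ∈ coeffSpan, (fun F : Series => φ (F e)) ∈ seriesSpan := by
    intro φ hφ
    induction hφ using Submodule.span_induction with
    | mem φ h => obtain ⟨N, rfl⟩ := h; exact Submodule.subset_span ⟨(e, N), rfl⟩
    | zero => exact seriesSpan.zero_mem
    | add φ ψ _ _ h1 h2 => exact seriesSpan.add_mem h1 h2
    | smul a φ _ h => exact seriesSpan.smul_mem a h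
  exact this _ (hf M)

theorem Finitary.comp_mem {D : Series → Series} (hD : Finitary D) {φ : Series → ℚ}
    (hφ : φ ∈ seriesSpan) : (fun F => φ (D F)) ∈ seriesSpan := by
  induction hφ using Submodule.span_induction with
  | mem φ h => obtain ⟨k, rfl⟩ := h; exact hD k.1 k.2
  | zero => exact seriesSpan.zero_mem
  | add φ ψ _ _ h1 h2 => exact seriesSpan.add_mem h1 h2
  | smul a φ _ h => exact seriesSpan.smul_mem a h

theorem Finitary.comp {D E : Series → Series} (hD : Finitary D) (hE : Finitary E) :
    Finitary fun F => D (E F) := fun e M => hE.comp_mem (hD e M)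

theorem finitary_id : Finitary fun F => F := fun e M => Submodule.subset_span ⟨(e, M), rfl⟩

theorem Finitary.iterate {D : Series → Series} (hD : Finitary D) (k : ℕ) : Finitary D^[k] := by
  induction k with
  | zero => exact finitary_id
  | succ k ih =>
    rw [Function.iterate_succ']
    exact hD.comp ih

theorem finitary_foldr (l : List (Series → Series)) (h : ∀ D ∈ l, Finitary D) :
    Finitary fun F => l.foldr (fun E G => E G) F := by
  induction l with
  | nil => exact finitary_id
  | cons D l ih =>
    exact (h D List.mem_cons_self).comp (ih fun E hE => h E (List.mem_cons_of_mem _ hE))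

/-- Both claims hold for a single coefficient and persist under finite linear combinations. This is
why finitary operators commute with formal sums. -/
theorem seriesSpan_formalSum {φ : Series → ℚ} (hφ : φ ∈ seriesSpan) {ι : Type*} {f : ι → Series}
    (hf : FormallySummable f) :
    {i | φ (f i) ≠ 0}.Finite ∧ φ (formalSum f) = ∑ᶠ i, φ (f i) := by
  induction hφ using Submodule.span_induction with
  | mem φ h => obtain ⟨k, rfl⟩ := h; exact ⟨hf k.1 k.2, rfl⟩
  | zero => simp
  | add φ ψ _ _ h1 h2 =>
    refine ⟨(h1.1.union h2.1).subset fun i hi => ?_, ?_⟩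
    · by_contra h
      simp only [Set.mem_union, Set.mem_ofPred_eq, not_or, not_not] at h
      exact hi (by simp [h.1, h.2])
    · simp only [Pi.add_apply]
      rw [h1.2, h2.2, finsum_add_distrib h1.1 h2.1]
  | smul a φ _ h =>
    refine ⟨h.1.subset fun i hi h0 => hi (by simp [h0]), ?_⟩
    simp only [Pi.smul_apply, smul_eq_mul]
    rw [h.2, mul_finsum' _ _ h.1]

theorem Finitary.map_formalSum {D : Series → Series} (hD : Finitary D) {ι : Type*}
    {f : ι → Series} (hf : FormallySummable f) :
    D (formalSum f) = formalSum fun i => D (f i) :=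
  Series.ext_coeff fun e M => (seriesSpan_formalSum (hD e M) hf).2

theorem isLinearMap_of_mem_seriesSpan {φ : Series → ℚ} (hφ : φ ∈ seriesSpan) :
    IsLinearMap ℚ φ := by
  induction hφ using Submodule.span_induction with
  | mem φ h =>
    obtain ⟨k, rfl⟩ := h
    exact ⟨fun F G => by simp [Series.coeff], fun a F => coeff_smul a F _ _⟩
  | zero => exact ⟨by simp, by simp⟩
  | add φ ψ _ _ h1 h2 =>
    refine ⟨fun F G => ?_, fun a F => ?_⟩
    · simp only [Pi.add_apply, h1.map_add, h2.map_add]; ring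
    · simp only [Pi.add_apply, h1.map_smul, h2.map_smul, smul_add]
  | smul a φ _ h =>
    refine ⟨fun F G => ?_, fun b F => ?_⟩
    · simp only [Pi.smul_apply, h.map_add, smul_add]
    · simp only [Pi.smul_apply, h.map_smul, smul_comm a b]

theorem Finitary.isLinearMap {D : Series → Series} (hD : Finitary D) : IsLinearMap ℚ D where
  map_add F G := Series.ext_coeff fun e M =>
    ((isLinearMap_of_mem_seriesSpan (hD e M)).map_add F G).trans (by simp [Series.coeff])
  map_smul a F := Series.ext_coeff fun e M =>
    ((isLinearMap_of_mem_seriesSpan (hD e M)).map_smul a F).trans (coeff_smul a _ e M).symm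

/-- The finite set `s` has to serve all `F` at once; summability for each `F` separately would not
give one fixed linear combination. -/
theorem finitary_of_finset {ι : Type*} {D : ι → Series → Series} {E : Series → Series}
    (hE : ∀ F, E F = formalSum fun i => D i F) (hD : ∀ i, Finitary (D i))
    (hs : ∀ e M, ∃ s : Finset ι, ∀ F i, (D i F).coeff e M ≠ 0 → i ∈ s) : Finitary E :=
  fun e M => by
    obtain ⟨s, hs⟩ := hs e M
    have : (fun F => (E F).coeff e M) = ∑ i ∈ s, fun F => (D i F).coeff e M := by
      funext F
      rw [hE, coeff_formalSum, finsum_eq_sum_of_support_subset (s := s) _ fun i => hs F i]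
      simp
    rw [this]
    exact seriesSpan.sum_mem fun i _ => hD i e M

theorem le_of_coeff_pow_dvd {v : Var} {k : ℕ} {P : PS}
    (h : (MvPowerSeries.X v : PS) ^ k ∣ P) {M : Var →₀ ℕ} (hM : MvPowerSeries.coeff M P ≠ 0) :
    k ≤ M v := by
  by_contra hlt
  exact hM (MvPowerSeries.X_pow_dvd_iff.1 h M (not_le.1 hlt))

theorem Finitary.expOp {D : Series → Series} (hD : Finitary D) (j : ℕ) :
    Finitary (expOp j D) := by
  refine finitary_of_finset (D := fun l F => expOpTerm j D F l) (fun F => rfl) (fun l => ?_) ?_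
  · have h1 : Finitary fun F : Series => fun e => ((l.factorial : ℚ)⁻¹ • uVar j ^ l) * F e :=
      fun e M => (finitaryPS_mul_left _).mem_seriesSpan e M
    exact h1.comp (hD.iterate l)
  · intro e M
    refine ⟨Finset.range (M (uIdx j) + 1), fun F l h => ?_⟩
    have hdvd : (MvPowerSeries.X (uIdx j) : PS) ^ l ∣ expOpTerm j D F l e := by
      unfold expOpTerm uVar
      rw [smul_mul_assoc, ← mul_smul_comm]
      exact Dvd.intro _ rfl
    exact Finset.mem_range_succ_iff.2 (le_of_coeff_pow_dvd hdvd h)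

/-! #### The cut-and-join operators -/

theorem multiset_sum_fst (T : Multiset Triple) : (T.map fun t => t.1).sum = T.sum.1 :=
  (map_multiset_sum (AddMonoidHom.fst Ptn (Ptn × Ptn)) T).symm

theorem multiset_sum_mid (T : Multiset Triple) : (T.map fun t => t.2.1).sum = T.sum.2.1 :=
  (map_multiset_sum ((AddMonoidHom.fst Ptn Ptn).comp (AddMonoidHom.snd Ptn (Ptn × Ptn))) T).symm

theorem multiset_sum_snd (T : Multiset Triple) : (T.map fun t => t.2.2).sum = T.sum.2.2 :=
  (map_multiset_sum ((AddMonoidHom.snd Ptn Ptn).comp (AddMonoidHom.snd Ptn (Ptn × Ptn))) T).symm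

theorem pVar_pow_dvd_ptnPow {Γ : Ptn} {a : ℕ+} (ha : a ≠ 1) :
    (MvPowerSeries.X (pIdx a) : PS) ^ Γ a ∣ ptnPow pShift Γ := by
  by_cases h : a ∈ Γ.support
  · have : (MvPowerSeries.X (pIdx a) : PS) ^ Γ a = pShift a ^ Γ a := by simp [pShift, ha, pVar]
    rw [this]
    exact Finset.dvd_prod_of_mem (fun a => pShift a ^ Γ a) h
  · rw [Finsupp.notMem_support_iff.1 h, pow_zero]
    exact one_dvd _

theorem Decomp.card_le {Δ : Ptn} (T : Decomp Δ) : Multiset.card T.1 ≤ size Δ := by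
  have := card_le_midSize T.2.2
  rwa [midSize_apply, ← multiset_sum_mid, T.2.1] at this

theorem pIdx_injective : Function.Injective pIdx :=
  Sum.inr_injective.comp Sum.inr_injective

/-- A nonzero weight forces |Γ'ᵢ| = |Γᵢ| ≤ |B|; moreover Δⁱ ≤ Δ, and there are at most |Δ| members.
-/
theorem finite_decomp (Δ B : Ptn) :
    {T : Decomp Δ | (T.1.map tripleWeight).prod ≠ 0 ∧ T.1.sum.2.2 ≤ B}.Finite := by
  refine Set.Finite.of_finite_image (f := Subtype.val) ?_ Subtype.val_injective.injOn
  have hfin : {t : Triple | size t.1 ≤ size B ∧ t.2.1 ≤ Δ ∧ t.2.2 ≤ B}.Finite := by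
    refine ((finite_size_le (size B)).prod ((Set.finite_Iic Δ).prod (Set.finite_Iic B))).subset ?_
    rintro ⟨x, y, w⟩ ⟨h1, h2, h3⟩
    exact ⟨h1, h2, h3⟩
  refine (finite_families (size Δ) hfin).subset ?_
  rintro _ ⟨T, ⟨hT, hB⟩, rfl⟩
  refine ⟨T.card_le, fun t ht => ?_⟩
  have hle := le_sum_of_mem ht
  have h0 : tripleWeight t ≠ 0 := fun h => hT (Multiset.prod_eq_zero (by
    rw [← h]; exact Multiset.mem_map_of_mem _ ht))
  have hB' : t.2.2 ≤ B := hle.2.2.trans hB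
  refine ⟨?_, ?_, hB'⟩
  · rw [← size_eq_of_tripleWeight_ne_zero h0]; exact size_mono hB'
  · rw [← T.2.1, multiset_sum_mid]; exact hle.2.1

/-- For a ≠ 1 the term is divisible by p_a^{m_a(Γ)}, so `M` bounds m_a(Γ). The multiplier p₁ + 1
gives no divisibility; there m₁(Γ) ≤ |Δ| follows by adding up `fixed_le_of_tripleWeight_ne_zero`
over the members. The bound `B` combines both. -/
theorem cutJoinTerm_support (Δ : Ptn) (e : ℤ) (M : Var →₀ ℕ) :
    ∃ s : Finset (Decomp Δ), ∀ F T, (cutJoinTerm pShift Δ F T).coeff e M ≠ 0 → T ∈ s := by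
  let B : Ptn := Finsupp.comapDomain pIdx M pIdx_injective.injOn + Finsupp.single 1 (size Δ)
  refine ⟨(finite_decomp Δ B).toFinset, fun F T h => ?_⟩
  rw [Set.Finite.mem_toFinset]
  simp only [Series.coeff, cutJoinTerm, map_smul, smul_eq_mul] at h
  have hw : (T.1.map tripleWeight).prod ≠ 0 := fun h0 => h (by rw [h0]; simp)
  refine ⟨hw, fun a => ?_⟩
  have hB : B a = M (pIdx a) + Finsupp.single 1 (size Δ) a := by simp [B]
  rw [hB]
  by_cases ha : a = 1
  · subst ha
    rw [Finsupp.single_eq_same]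
    refine le_trans ?_ (Nat.le_add_left _ _)
    have h1 : T.1.sum.2.2 1 = (T.1.map fun t => t.2.2 1).sum :=
      map_multiset_sum ((Finsupp.applyAddHom (1 : ℕ+)).comp
        ((AddMonoidHom.snd Ptn Ptn).comp (AddMonoidHom.snd Ptn (Ptn × Ptn)))) T.1
    have h2 : size Δ = (T.1.map fun t => size t.2.1).sum := by
      refine (congrArg size T.2.1).symm.trans ?_
      rw [multiset_sum_mid]
      exact midSize_multiset_sum T.1
    rw [h1, h2]
    refine Multiset.sum_map_le_sum_map _ _ fun t ht => ?_
    refine fixed_le_of_tripleWeight_ne_zero (fun h0 => hw (Multiset.prod_eq_zero ?_)) (T.2.2 t ht)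
    rw [← h0]; exact Multiset.mem_map_of_mem _ ht
  · refine le_trans ?_ (Nat.le_add_right _ _)
    refine le_of_coeff_pow_dvd ?_ (right_ne_zero_of_mul h)
    rw [multiset_sum_snd]
    exact (pVar_pow_dvd_ptnPow ha).mul_right _

theorem cutJoinTerm_summable (Δ : Ptn) (F : Series) :
    FormallySummable (cutJoinTerm pShift Δ F) := fun e M => by
  obtain ⟨s, hs⟩ := cutJoinTerm_support Δ e M
  exact s.finite_toSet.subset fun T hT => hs F T hT

theorem finitary_cutJoin (Δ : Ptn) : Finitary (cutJoin pShift Δ) := by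
  refine finitary_of_finset (D := fun T F => cutJoinTerm pShift Δ F T) (fun F => rfl)
    (fun T e M => ?_) (cutJoinTerm_support Δ)
  exact (((finitaryPS_mul_left _).comp (finitaryPS_ptnDeriv _)).smul _).mem_seriesSpan _ M

theorem finitary_evolution {m : ℕ} (ι : Fin m → ℕ) (Δ : Fin m → Ptn) :
    Finitary fun F => (List.ofFn fun j => expOp (ι j) (cutJoin pShift (Δ j))).foldr
      (fun E G => E G) F := by
  refine finitary_foldr _ fun D hD => ?_
  obtain ⟨j, rfl⟩ := (List.mem_ofFn' _ _).1 hD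
  exact (finitary_cutJoin (Δ j)).expOp (ι j)

/-! ### The action of the cut-and-join operators on monomials -/

theorem ptnPow_add (x : ℕ+ → PS) (Γ Γ' : Ptn) :
    ptnPow x (Γ + Γ') = ptnPow x Γ * ptnPow x Γ' := by
  unfold ptnPow
  exact Finsupp.prod_add_index' (by simp) (by intros; rw [pow_add])

theorem ptnPow_single (x : ℕ+ → PS) (a : ℕ+) (k : ℕ) :
    ptnPow x (Finsupp.single a k) = x a ^ k := by
  simp [ptnPow]

theorem pderiv_pShift (a b : ℕ+) :
    MvPowerSeries.pderiv ℚ (pIdx a) (pShift b) = if a = b then 1 else 0 := by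
  have h1 : MvPowerSeries.pderiv ℚ (pIdx a) (if b = 1 then (1 : PS) else 0) = 0 := by
    split_ifs
    · exact Derivation.map_one_eq_zero _
    · exact map_zero _
  rw [pShift, map_add, h1, add_zero, pVar]
  split_ifs with h
  · subst h
    exact MvPowerSeries.pderiv_X_self ..
  · exact MvPowerSeries.pderiv_X_of_ne fun h' => h (pIdx_injective h').symm

theorem pderiv_pow_of_eq_zero {v : Var} {P : PS} (h : MvPowerSeries.pderiv ℚ v P = 0) (k : ℕ) :
    MvPowerSeries.pderiv ℚ v (P ^ k) = 0 := by
  rw [Derivation.leibniz_pow, h]; simp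

theorem pderiv_mul_of_eq_zero {v : Var} {P Q : PS} (h : MvPowerSeries.pderiv ℚ v P = 0)
    (h' : MvPowerSeries.pderiv ℚ v Q = 0) : MvPowerSeries.pderiv ℚ v (P * Q) = 0 := by
  rw [Derivation.leibniz, h, h']; simp

theorem pderiv_prod_of_eq_zero {ι : Type*} {v : Var} (s : Finset ι) {P : ι → PS}
    (h : ∀ i ∈ s, MvPowerSeries.pderiv ℚ v (P i) = 0) :
    MvPowerSeries.pderiv ℚ v (∏ i ∈ s, P i) = 0 :=
  Finset.prod_induction _ (fun P => MvPowerSeries.pderiv ℚ v P = 0)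
    (fun _ _ => pderiv_mul_of_eq_zero) (Derivation.map_one_eq_zero _) h

/-- `P` does not depend on the time variables `p_a`. -/
def IsTimeFree (P : PS) : Prop := ∀ a, MvPowerSeries.pderiv ℚ (pIdx a) P = 0

/-- The shift by a constant does not affect derivatives. For `Λ a = 0` the truncated difference is
harmless, since the coefficient is 0. -/
theorem pderiv_mul_ptnPow {P : PS} (hP : IsTimeFree P) (a : ℕ+) (Λ : Ptn) :
    MvPowerSeries.pderiv ℚ (pIdx a) (P * ptnPow pShift Λ) =
      (Λ a : ℚ) • (P * ptnPow pShift (Λ - Finsupp.single a 1)) := by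
  have h0 : MvPowerSeries.pderiv ℚ (pIdx a) (ptnPow pShift (Λ.erase a)) = 0 := by
    refine pderiv_prod_of_eq_zero _ fun b hb => pderiv_pow_of_eq_zero ?_ _
    rw [pderiv_pShift, if_neg]
    rintro rfl
    simp at hb
  have h1 : ptnPow pShift Λ = pShift a ^ Λ a * ptnPow pShift (Λ.erase a) := by
    rw [← ptnPow_single, ← ptnPow_add, Finsupp.single_add_erase]
  have h2 : ptnPow pShift (Λ - Finsupp.single a 1) =
      pShift a ^ (Λ a - 1) * ptnPow pShift (Λ.erase a) := by
    rw [← ptnPow_single, ← ptnPow_add]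
    congr 1
    ext b
    by_cases hb : a = b
    · subst hb; simp
    · simp [hb, Finsupp.erase_ne (Ne.symm hb)]
  rw [h1, h2, Derivation.leibniz, hP a, smul_zero, add_zero, Derivation.leibniz, h0, smul_zero,
    zero_add, Derivation.leibniz_pow, pderiv_pShift, if_pos rfl]
  simp only [smul_eq_mul, mul_one, nsmul_eq_mul, Algebra.smul_def, map_natCast]
  ring

theorem iterate_pderiv_mul_ptnPow {P : PS} (hP : IsTimeFree P) (a : ℕ+) (k : ℕ) (Λ : Ptn) :
    (MvPowerSeries.pderiv ℚ (pIdx a))^[k] (P * ptnPow pShift Λ) =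
      ((Λ a).descFactorial k : ℚ) • (P * ptnPow pShift (Λ - Finsupp.single a k)) := by
  induction k with
  | zero => simp
  | succ k ih =>
    rw [Function.iterate_succ_apply', ih, Derivation.map_smul, pderiv_mul_ptnPow hP, smul_smul,
      tsub_tsub, ← Finsupp.single_add, Nat.descFactorial_succ]
    congr 1
    rw [Finsupp.tsub_apply, Finsupp.single_eq_same]
    push_cast
    ring

/-- The coefficient of `∂/∂p_Γ p_Λ`. -/
def fallingFactor (Λ Γ : Ptn) : ℕ := Γ.prod fun a k => (Λ a).descFactorial k

theorem ptnDeriv_mul_ptnPow {P : PS} (hP : IsTimeFree P) (Γ Λ : Ptn) :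
    ptnDeriv Γ (P * ptnPow pShift Λ) =
      (fallingFactor Λ Γ : ℚ) • (P * ptnPow pShift (Λ - Γ)) := by
  -- Without repetitions in `l`, each derivative still meets the original exponent `Λ a`.
  have key : ∀ l : List ℕ+, l.Nodup →
      l.foldr (fun a Q => (MvPowerSeries.pderiv ℚ (pIdx a))^[Γ a] Q) (P * ptnPow pShift Λ) =
        ((l.map fun a => (Λ a).descFactorial (Γ a)).prod : ℚ) •
          (P * ptnPow pShift (Λ - (l.map fun a => Finsupp.single a (Γ a)).sum)) := by
    intro l hl
    induction l with
    | nil => simp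
    | cons a l ih =>
      obtain ⟨ha, hl⟩ := List.nodup_cons.1 hl
      have h0 : ∀ l : List ℕ+, a ∉ l → (l.map fun a => Finsupp.single a (Γ a)).sum a = 0 := by
        intro l hl
        induction l with
        | nil => simp
        | cons b l ih =>
          simp only [List.mem_cons, not_or] at hl
          simp [ih hl.2, Ne.symm hl.1]
      have hsm : ∀ (k : ℕ) (r : ℚ) (Q : PS), (MvPowerSeries.pderiv ℚ (pIdx a))^[k] (r • Q) =
          r • (MvPowerSeries.pderiv ℚ (pIdx a))^[k] Q := by
        intro k r Q
        induction k with
        | zero => rfl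
        | succ k ih => rw [Function.iterate_succ_apply', ih, Derivation.map_smul,
            Function.iterate_succ_apply']
      rw [List.foldr_cons, ih hl, hsm, iterate_pderiv_mul_ptnPow hP, smul_smul, tsub_tsub,
        Finsupp.tsub_apply, h0 l ha, Nat.sub_zero, List.map_cons, List.map_cons, List.sum_cons,
        List.prod_cons, add_comm]
      congr 1
      push_cast
      ring
  rw [ptnDeriv, key _ (Finset.sort_nodup _ _), fallingFactor, Finsupp.prod]
  congr 4
  · rw [← Multiset.prod_coe, ← Multiset.map_coe, Finset.sort_eq]; rfl
  · rw [← Multiset.sum_coe, ← Multiset.map_coe, Finset.sort_eq]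
    exact Finsupp.sum_single Γ

theorem fallingFactor_eq_zero {Λ Γ : Ptn} (h : ¬Γ ≤ Λ) : fallingFactor Λ Γ = 0 := by
  obtain ⟨a, ha⟩ : ∃ a, Λ a < Γ a := by
    by_contra hcon
    simp only [not_exists, not_lt] at hcon
    exact h hcon
  refine Finset.prod_eq_zero (i := a) ?_ (Nat.descFactorial_of_lt ha)
  simp; omega

/-- In other words, ‖Γ‖ ∂/∂p_Γ sends q_Λ/z_Λ to q_{Λ-Γ}/z_{Λ-Γ}. This explains the factor ‖Γ'‖ in
the operator. -/
theorem partsProd_mul_fallingFactor {Λ Γ : Ptn} (h : Γ ≤ Λ) :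
    partsProd Γ * fallingFactor Λ Γ * centralizerSize (Λ - Γ) = centralizerSize Λ := by
  have hsub : Γ.support ⊆ Λ.support := Finsupp.support_mono h
  have hsub' : (Λ - Γ).support ⊆ Λ.support := Finsupp.support_mono tsub_le_self
  have h1 : fallingFactor Λ Γ * ((Λ - Γ).prod fun _ m => m.factorial) =
      Λ.prod fun _ m => m.factorial := by
    rw [fallingFactor, Finsupp.prod_of_support_subset _ hsub _ (by simp),
      Finsupp.prod_of_support_subset _ hsub' _ (by simp), Finsupp.prod, ← Finset.prod_mul_distrib]
    refine Finset.prod_congr rfl fun a _ => ?_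
    rw [Finsupp.tsub_apply, mul_comm]
    exact Nat.factorial_mul_descFactorial (h a)
  have h2 : partsProd Γ * partsProd (Λ - Γ) = partsProd Λ := by
    rw [← partsProd_add, add_comm, tsub_add_cancel_of_le h]
  rw [centralizerSize, centralizerSize, ← h1, ← h2]
  ring

/-- `z^{c - l(Λ)} P q_Λ` for the shifted time variables `q`. -/
def monom (c : ℤ) (P : PS) (Λ : Ptn) : Series := zMonomial (c - len Λ) (P * ptnPow pShift Λ)

theorem prod_tripleWeight (T : Multiset Triple) :
    (T.map tripleWeight).prod = partsProd T.sum.1 * (T.map connWeight).prod := by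
  induction T using Multiset.induction_on with
  | empty => simp [partsProd]
  | cons t T ih =>
    rw [Multiset.map_cons, Multiset.prod_cons, ih, Multiset.map_cons, Multiset.prod_cons,
      Multiset.sum_cons, Prod.fst_add, partsProd_add, tripleWeight_eq]
    push_cast
    ring

open Classical in
/-- The result of the term of `T` on `q_Λ`. -/
def familyAction (c : ℤ) (P : PS) (Λ : Ptn) (T : Multiset Triple) : Series :=
  if T.sum.1 ≤ Λ then
    (centralizerSize Λ * familyWeight connWeight T * (centralizerSize (Λ - T.sum.1) : ℚ)⁻¹) •
      monom c P (Λ - T.sum.1 + T.sum.2.2)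
  else 0

theorem zMonomial_smul (c : ℤ) (a : ℚ) (P : PS) : zMonomial c (a • P) = a • zMonomial c P :=
  funext fun e => by
    by_cases h : e = c
    · subst h; simp [zMonomial]
    · simp [zMonomial, h]

/-- The power z^{l(Γ')-l(Γ)} compensates the change of length from Λ to Λ - Γ' + Γ, so `c` only
moves by |Δ| - l(Δ). -/
theorem cutJoinTerm_monom {P : PS} (hP : IsTimeFree P) (c : ℤ) (Λ Δ : Ptn) (T : Decomp Δ) :
    cutJoinTerm pShift Δ (monom c P Λ) T =
      familyAction (c + ((size Δ : ℤ) - len Δ)) P Λ T.1 := by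
  classical
  have hterm : cutJoinTerm pShift Δ (monom c P Λ) T =
      zMonomial (c - len Λ + ((size Δ : ℤ) - len Δ + len T.1.sum.1 - len T.1.sum.2.2))
        (((T.1.map tripleWeight).prod / (autCard T.1 : ℚ)) •
          (ptnPow pShift T.1.sum.2.2 * ptnDeriv T.1.sum.1 (P * ptnPow pShift Λ))) := by
    have hd0 : ∀ Γ, ptnDeriv Γ (0 : PS) = 0 := by
      intro Γ
      have h0 : (0 : PS) = 0 * ptnPow pShift 0 := by simp
      rw [h0, ptnDeriv_mul_ptnPow (fun a => map_zero _)]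
      simp
    funext e
    simp only [cutJoinTerm, monom, zMonomial, multiset_sum_fst, multiset_sum_snd]
    by_cases he : e = c - len Λ + ((size Δ : ℤ) - len Δ + len T.1.sum.1 - len T.1.sum.2.2)
    · subst he
      rw [Pi.single_eq_same, add_sub_cancel_right, Pi.single_eq_same]
    · rw [Pi.single_eq_of_ne he, Pi.single_eq_of_ne, hd0, mul_zero, smul_zero]
      intro h
      exact he (by linarith)
  rw [hterm, ptnDeriv_mul_ptnPow hP, familyAction]
  split_ifs with h
  · have hz : (centralizerSize Λ : ℚ) = partsProd T.1.sum.1 * fallingFactor Λ T.1.sum.1 *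
        centralizerSize (Λ - T.1.sum.1) := by
      exact_mod_cast (partsProd_mul_fallingFactor h).symm
    have hz0 : (centralizerSize (Λ - T.1.sum.1) : ℚ) ≠ 0 := by
      exact_mod_cast (centralizerSize_pos _).ne'
    have hlen : len Λ = len (Λ - T.1.sum.1) + len T.1.sum.1 := by
      rw [← len_add, tsub_add_cancel_of_le h]
    rw [monom, ← zMonomial_smul, hz, familyWeight, prod_tripleWeight, mul_smul_comm, smul_smul,
      ptnPow_add, len_add, hlen]
    congr 1
    · push_cast; ring
    · congr 1
      · field_simp
      · ring
  · rw [fallingFactor_eq_zero h]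
    simp [zMonomial]

/-- The partitions of the size of `Λ`. -/
def sameSize (Λ : Ptn) : Finset Ptn :=
  ((finite_size_le (size Λ)).subset (fun Γ (h : size Γ = size Λ) => h.le) :
    {Γ | size Γ = size Λ}.Finite).toFinset

theorem mem_sameSize {Λ Γ : Ptn} : Γ ∈ sameSize Λ ↔ size Γ = size Λ := by
  simp [sameSize]

theorem size_sum_eq_of_prod_ne_zero {T : Multiset Triple} (h : (T.map tripleWeight).prod ≠ 0) :
    size T.sum.2.2 = size T.sum.1 := by
  have h1 : size T.sum.1 = (T.map fun t => size t.1).sum :=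
    map_multiset_sum (sizeHom.comp (AddMonoidHom.fst Ptn (Ptn × Ptn))) T
  have h2 : size T.sum.2.2 = (T.map fun t => size t.2.2).sum :=
    map_multiset_sum (sizeHom.comp ((AddMonoidHom.snd Ptn Ptn).comp
      (AddMonoidHom.snd Ptn (Ptn × Ptn)))) T
  rw [h1, h2]
  congr 1
  refine Multiset.map_congr rfl fun t ht => size_eq_of_tripleWeight_ne_zero fun h0 => ?_
  exact h (Multiset.prod_eq_zero (by rw [← h0]; exact Multiset.mem_map_of_mem _ ht))

/-- The trivial weight of the remainder vanishes unless the family uses up Δ and Γ is what the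
family makes of Λ, so at most one Γ survives. -/
theorem sum_familyAction {P : PS} (c : ℤ) (Λ Δ : Ptn) (T : Multiset Triple)
    [∀ Γ, Decidable (T.sum ≤ (Λ, Δ, Γ))]
    [Decidable (T.sum.2.1 = Δ)] :
    ∑ Γ ∈ sameSize Λ, (if T.sum ≤ (Λ, Δ, Γ) then
      ((centralizerSize Λ : ℚ) * (familyWeight connWeight T *
        trivialWeight ((Λ, Δ, Γ) - T.sum))) • monom c P Γ else 0) =
      if T.sum.2.1 = Δ then familyAction c P Λ T else 0 := by
  classical
  -- Only a nonzero weight guarantees that the family preserves the size, so that the surviving Γ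
  -- lies in `sameSize Λ`.
  by_cases h0 : (T.map tripleWeight).prod = 0
  · have h1 : familyWeight connWeight T = 0 := by
      rw [prod_tripleWeight] at h0
      have : (partsProd T.sum.1 : ℚ) ≠ 0 := by exact_mod_cast (partsProd_pos _).ne'
      rw [familyWeight, (mul_eq_zero.1 h0).resolve_left this, zero_div]
    simp [h1, familyAction]
  by_cases hΔ : T.sum.2.1 = Δ
  · rw [if_pos hΔ, familyAction]
    split_ifs with hΛ
    · rw [Finset.sum_eq_single (Λ - T.sum.1 + T.sum.2.2)]
      · rw [if_pos ⟨hΛ, hΔ.le, le_add_self⟩, trivialWeight, if_pos]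
        · simp only [Prod.fst_sub, mul_assoc]
        · refine ⟨?_, ?_⟩
          · simp [hΔ]
          · simp
      · intro Γ _ hΓ
        split_ifs with hle
        · rw [trivialWeight, if_neg]
          · simp
          · rintro ⟨-, h⟩
            simp only [Prod.fst_sub, Prod.snd_sub] at h
            refine hΓ ?_
            rw [h, tsub_add_cancel_of_le hle.2.2]
        · rfl
      · intro h
        refine absurd (mem_sameSize.2 ?_) h
        rw [size_add, size_sum_eq_of_prod_ne_zero h0, ← size_add, tsub_add_cancel_of_le hΛ]
    · refine Finset.sum_eq_zero fun Γ _ => if_neg fun hle => hΛ hle.1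
  · rw [if_neg hΔ]
    refine Finset.sum_eq_zero fun Γ _ => ?_
    split_ifs with hle
    · rw [trivialWeight, if_neg]
      · simp
      · rintro ⟨h, -⟩
        simp only [Prod.fst_sub, Prod.snd_sub] at h
        exact hΔ (le_antisymm hle.2.1 (tsub_eq_zero_iff_le.1 h))
    · rfl

/-- Collecting the families by the resulting Γ produces exactly the family sum that the exponential
formula identifies with `configWeight`. Families outside the finite set `s` contribute nothing. -/
theorem cutJoin_monom {P : PS} (hP : IsTimeFree P) (c : ℤ) (Λ Δ : Ptn) :
    cutJoin pShift Δ (monom c P Λ) = ∑ Γ ∈ sameSize Λ,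
      ((centralizerSize Λ : ℚ) * configWeight (Λ, Δ, Γ)) •
        monom (c + ((size Δ : ℤ) - len Δ)) P Γ := by
  classical
  set c' := c + ((size Δ : ℤ) - len Δ)
  let fam : Ptn → Finset (Multiset Triple) := fun Γ => (finite_familiesBelow (Λ, Δ, Γ)).toFinset
  let s : Finset (Multiset Triple) := (sameSize Λ).biUnion fam
  have hmem : ∀ Γ T, T ∈ fam Γ ↔ T ∈ familiesBelow (Λ, Δ, Γ) := fun Γ T => by simp [fam]
  have hspos : ∀ T ∈ s, ∀ t ∈ T, 1 ≤ midSize t := by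
    intro T hT
    obtain ⟨Γ, -, hΓ⟩ := Finset.mem_biUnion.1 hT
    exact ((hmem Γ T).1 hΓ).2
  have hR : ∑ Γ ∈ sameSize Λ, ((centralizerSize Λ : ℚ) * configWeight (Λ, Δ, Γ)) • monom c' P Γ =
      ∑ T ∈ s, if T.sum.2.1 = Δ then familyAction c' P Λ T else 0 := by
    have h1 : ∀ Γ ∈ sameSize Λ,
        ((centralizerSize Λ : ℚ) * configWeight (Λ, Δ, Γ)) • monom c' P Γ =
        ∑ T ∈ s, if T.sum ≤ (Λ, Δ, Γ) then ((centralizerSize Λ : ℚ) *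
          (familyWeight connWeight T * trivialWeight ((Λ, Δ, Γ) - T.sum))) • monom c' P Γ
        else 0 := by
      intro Γ hΓ
      rw [configWeight_eq_familySum, familySum, Finset.mul_sum, Finset.sum_smul,
        ← Finset.sum_filter]
      refine Finset.sum_congr ?_ fun _ _ => rfl
      ext T
      rw [Finset.mem_filter]
      constructor
      · intro hT
        exact ⟨Finset.mem_biUnion.2 ⟨Γ, hΓ, hT⟩, ((hmem Γ T).1 hT).1⟩
      · rintro ⟨hT, hle⟩
        exact (hmem Γ T).2 ⟨hle, hspos T hT⟩
    rw [Finset.sum_congr rfl h1, Finset.sum_comm]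
    exact Finset.sum_congr rfl fun T _ => sum_familyAction c' Λ Δ T
  rw [hR]
  let p : Multiset Triple → Prop :=
    fun T => (T.map fun t => t.2.1).sum = Δ ∧ ∀ t ∈ T, 1 ≤ size t.2.1
  have hL : cutJoin pShift Δ (monom c P Λ) = ∑ T ∈ s.subtype p, familyAction c' P Λ T.1 := by
    have : cutJoinTerm pShift Δ (monom c P Λ) = fun T : Decomp Δ => familyAction c' P Λ T.1 :=
      funext fun T => cutJoinTerm_monom hP c Λ Δ T
    rw [cutJoin, this]
    refine formalSum_eq_sum (s.subtype p) fun T hT => ?_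
    rw [Finset.mem_subtype] at hT
    rw [familyAction]
    split_ifs with hΛ
    · by_contra hne
      have h0 : (T.1.map tripleWeight).prod ≠ 0 := by
        intro h0
        rw [prod_tripleWeight] at h0
        have : (partsProd T.1.sum.1 : ℚ) ≠ 0 := by exact_mod_cast (partsProd_pos _).ne'
        refine hne ?_
        rw [familyWeight, (mul_eq_zero.1 h0).resolve_left this]
        simp
      refine hT (Finset.mem_biUnion.2 ⟨Λ - T.1.sum.1 + T.1.sum.2.2, mem_sameSize.2 ?_,
        (hmem _ _).2 ⟨⟨hΛ, ?_, le_add_self⟩, T.2.2⟩⟩)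
      · rw [size_add, size_sum_eq_of_prod_ne_zero h0, ← size_add, tsub_add_cancel_of_le hΛ]
      · exact (multiset_sum_mid T.1).ge.trans T.2.1.le
    · rfl
  rw [hL, Finset.sum_subtype_eq_sum_filter, Finset.sum_filter]
  refine Finset.sum_congr rfl fun T hT => ?_
  have : p T ↔ T.sum.2.1 = Δ := by
    simp only [p, multiset_sum_mid]
    exact ⟨fun h => h.1, fun h => ⟨h, hspos T hT⟩⟩
  simp only [this]

/-! ### The group algebra of the symmetric group -/

section GroupAlgebra

variable {n : ℕ}

/-- The pairs of a permutation and a set that contains its support, of given type. -/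
def markedPerms (n : ℕ) (Δ : Ptn) : Finset (Perm (Fin n) × Finset (Fin n)) :=
  Finset.univ.filter fun p => p.1.support ⊆ p.2 ∧ typeOn p.1 p.2 = Δ

theorem mem_markedPerms {Δ : Ptn} {p : Perm (Fin n) × Finset (Fin n)} :
    p ∈ markedPerms n Δ ↔ p.1.support ⊆ p.2 ∧ typeOn p.1 p.2 = Δ := by
  simp [markedPerms]

/-- Conjugation of marked permutations. -/
def conjMarked (g : Perm (Fin n)) :
    Perm (Fin n) × Finset (Fin n) ≃ Perm (Fin n) × Finset (Fin n) :=
  Equiv.prodCongr g.permCongr g.finsetCongr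

theorem conjMarked_mem (g : Perm (Fin n)) (Δ : Ptn) (p : Perm (Fin n) × Finset (Fin n)) :
    p ∈ markedPerms n Δ ↔ conjMarked g p ∈ markedPerms n Δ := by
  rw [mem_markedPerms, mem_markedPerms]
  change _ ↔ (g.permCongr p.1).support ⊆ p.2.map g.toEmbedding ∧
    typeOn (g.permCongr p.1) (p.2.map g.toEmbedding) = Δ
  rw [support_permCongr, typeOn_permCongr, Finset.map_subset_map]

theorem conjMarked_fst (g : Perm (Fin n)) (p : Perm (Fin n) × Finset (Fin n)) :
    (conjMarked g p).1 = g * p.1 * g⁻¹ := by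
  ext a; rfl

theorem card_markedPerms_conj {σ σ' : Perm (Fin n)} (h : ptype σ = ptype σ') (Δ Γ : Ptn) :
    ((markedPerms n Δ).filter fun p => ptype (σ * p.1) = Γ).card =
      ((markedPerms n Δ).filter fun p => ptype (σ' * p.1) = Γ).card := by
  obtain ⟨g, hg⟩ := isConj_iff.1 (ptype_eq_iff.1 h)
  refine Finset.card_equiv (conjMarked g) fun p => ?_
  rw [Finset.mem_filter, Finset.mem_filter, ← conjMarked_mem, conjMarked_fst]
  have : σ' * (g * p.1 * g⁻¹) = g.permCongr (σ * p.1) := by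
    have h2 : g.permCongr (σ * p.1) = g * (σ * p.1) * g⁻¹ := by ext a; rfl
    rw [h2, ← hg]; group
  rw [this, ptype_permCongr]

/-- By conjugation the number of admissible (τ, d) is the same for every σ' in the class of σ, and
the class has n!/z elements, where z is the order of the centralizer. -/
theorem centralizerSize_mul_configWeight (σ : Perm (Fin n)) (Δ Γ : Ptn) :
    (centralizerSize (ptype σ) : ℚ) * configWeight (ptype σ, Δ, Γ) =
      ((markedPerms n Δ).filter fun p => ptype (σ * p.1) = Γ).card := by
  classical
  have hn : size (ptype σ) = n := by rw [size_ptype, Fintype.card_fin]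
  have hcount : configCount (Fin n) (ptype σ, Δ, Γ) =
      (Finset.univ.filter fun σ' : Perm (Fin n) => ptype σ' = ptype σ).card *
        ((markedPerms n Δ).filter fun p => ptype (σ * p.1) = Γ).card := by
    rw [configCount, configs, Finset.filter_filter, Finset.card_filter,
      ← Finset.univ_product_univ, Finset.sum_product, ← smul_eq_mul, ← Finset.sum_const,
      Finset.sum_filter]
    refine Finset.sum_congr rfl fun σ' _ => ?_
    split_ifs with h
    · rw [← card_markedPerms_conj h, markedPerms, Finset.filter_filter, Finset.card_filter]
      refine Finset.sum_congr rfl fun p _ => ?_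
      simp only [Config.type, Prod.mk.injEq, h, true_and, and_assoc]
    · refine Finset.sum_eq_zero fun p _ => if_neg ?_
      rintro ⟨-, hp⟩
      exact h (congrArg Prod.fst hp)
  have hc := card_ptype (X := Fin n) (ptype σ) (size_ptype σ)
  rw [Fintype.card_fin] at hc
  have hf : (n.factorial : ℚ) ≠ 0 := by positivity
  rw [configWeight, hn, hcount, ← mul_div_assoc,
    div_eq_iff hf, ← hc]
  push_cast
  ring

theorem cutJoin_monom_ptype {P : PS} (hP : IsTimeFree P) (c : ℤ) (Δ : Ptn) (σ : Perm (Fin n)) :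
    cutJoin pShift Δ (monom c P (ptype σ)) =
      ∑ p ∈ markedPerms n Δ, monom (c + ((size Δ : ℤ) - len Δ)) P (ptype (σ * p.1)) := by
  rw [cutJoin_monom hP, ← Finset.sum_fiberwise_of_maps_to (s := markedPerms n Δ)
    (t := sameSize (ptype σ)) (g := fun p => ptype (σ * p.1))]
  · refine Finset.sum_congr rfl fun Γ _ => ?_
    rw [centralizerSize_mul_configWeight, Nat.cast_smul_eq_nsmul, ← Finset.sum_const]
    refine Finset.sum_congr rfl fun p hp => ?_
    rw [(Finset.mem_filter.1 hp).2]
  · intro p _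
    rw [mem_sameSize, size_ptype, size_ptype]

/-! ### Class sums and the evolution of images of group algebra elements -/

/-- The sum of the permutations of type `Δ`, with their domains. -/
def classElt (n : ℕ) (Δ : Ptn) : MonoidAlgebra ℚ (Perm (Fin n)) :=
  ∑ p ∈ markedPerms n Δ, MonoidAlgebra.single p.1 1

/-- Conjugation permutes the marked permutations of a given type. -/
theorem classElt_commute (Δ : Ptn) (x : MonoidAlgebra ℚ (Perm (Fin n))) :
    Commute (classElt n Δ) x := by
  induction x using MonoidAlgebra.induction_linear with
  | zero => exact Commute.zero_right _
  | add x y hx hy => exact hx.add_right hy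
  | single g r =>
    rw [Commute, SemiconjBy, classElt, Finset.sum_mul, Finset.mul_sum]
    symm
    refine Finset.sum_equiv (conjMarked g) (conjMarked_mem g Δ) fun p _ => ?_
    rw [MonoidAlgebra.single_mul_single, MonoidAlgebra.single_mul_single, conjMarked_fst,
      inv_mul_cancel_right, mul_comm]

/-- The linear map that takes a permutation `σ` to `z^{c - l(σ)} P q_σ`. -/
def permSeries (c : ℤ) (P : PS) : MonoidAlgebra ℚ (Perm (Fin n)) →ₗ[ℚ] Series where
  toFun x := ∑ σ, x.coeff σ • monom c P (ptype σ)
  map_add' x y := by simp [add_smul, Finset.sum_add_distrib]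
  map_smul' a x := by simp [mul_smul, Finset.smul_sum]

theorem permSeries_apply (c : ℤ) (P : PS) (x : MonoidAlgebra ℚ (Perm (Fin n))) :
    permSeries c P x = ∑ σ, x.coeff σ • monom c P (ptype σ) := rfl

theorem permSeries_single (c : ℤ) (P : PS) (σ : Perm (Fin n)) (r : ℚ) :
    permSeries c P (MonoidAlgebra.single σ r) = r • monom c P (ptype σ) := by
  classical
  rw [permSeries_apply, Finset.sum_eq_single σ]
  · simp
  · intro τ _ h
    simp [h.symm]
  · simp

theorem cutJoin_permSeries {P : PS} (hP : IsTimeFree P) (c : ℤ) (Δ : Ptn)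
    (x : MonoidAlgebra ℚ (Perm (Fin n))) :
    cutJoin pShift Δ (permSeries c P x) =
      permSeries (c + ((size Δ : ℤ) - len Δ)) P (x * classElt n Δ) := by
  have hlin := (finitary_cutJoin Δ).isLinearMap
  induction x using MonoidAlgebra.induction_linear with
  | zero => simp [hlin.map_zero]
  | add x y hx hy => rw [map_add, hlin.map_add, hx, hy, add_mul, map_add]
  | single σ r =>
    rw [permSeries_single, hlin.map_smul, cutJoin_monom_ptype hP, classElt, Finset.mul_sum,
      map_sum, Finset.smul_sum]
    refine Finset.sum_congr rfl fun p _ => ?_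
    rw [MonoidAlgebra.single_mul_single, permSeries_single, mul_one]

theorem iterate_cutJoin_permSeries {P : PS} (hP : IsTimeFree P) (c : ℤ) (Δ : Ptn) (l : ℕ)
    (x : MonoidAlgebra ℚ (Perm (Fin n))) :
    (cutJoin pShift Δ)^[l] (permSeries c P x) =
      permSeries (c + l * ((size Δ : ℤ) - len Δ)) P (x * classElt n Δ ^ l) := by
  induction l with
  | zero => simp
  | succ l ih =>
    rw [Function.iterate_succ_apply', ih, cutJoin_permSeries hP, pow_succ, mul_assoc]
    congr 2
    push_cast; ring

theorem mul_monom (Q P : PS) (c : ℤ) (Λ : Ptn) (e : ℤ) :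
    Q * monom c P Λ e = monom c (Q * P) Λ e := by
  unfold monom zMonomial
  by_cases h : e = c - len Λ
  · subst h; simp [mul_assoc]
  · simp [h]

theorem mul_permSeries (Q P : PS) (c : ℤ) (x : MonoidAlgebra ℚ (Perm (Fin n))) (e : ℤ) :
    Q * permSeries c P x e = permSeries c (Q * P) x e := by
  simp [permSeries_apply, Finset.sum_apply, Finset.mul_sum, mul_monom]

theorem expOpTerm_permSeries {P : PS} (hP : IsTimeFree P) (c : ℤ) (Δ : Ptn) (j l : ℕ)
    (x : MonoidAlgebra ℚ (Perm (Fin n))) :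
    expOpTerm j (cutJoin pShift Δ) (permSeries c P x) l =
      permSeries (c + l * ((size Δ : ℤ) - len Δ)) (((l.factorial : ℚ)⁻¹ • uVar j ^ l) * P)
        (x * classElt n Δ ^ l) :=
  funext fun e => by
    rw [expOpTerm, iterate_cutJoin_permSeries hP, mul_permSeries]

theorem isTimeFree_mul {P Q : PS} (hP : IsTimeFree P) (hQ : IsTimeFree Q) :
    IsTimeFree (P * Q) := fun a => pderiv_mul_of_eq_zero (hP a) (hQ a)

theorem isTimeFree_smul {P : PS} (hP : IsTimeFree P) (r : ℚ) : IsTimeFree (r • P) := fun a => by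
  rw [Derivation.map_smul, hP a, smul_zero]

theorem isTimeFree_uVar_pow (j l : ℕ) : IsTimeFree (uVar j ^ l) := fun a =>
  pderiv_pow_of_eq_zero (MvPowerSeries.pderiv_X_of_ne (by simp [uIdx, pIdx])) l

theorem isTimeFree_prod {ι : Type*} (s : Finset ι) {P : ι → PS} (h : ∀ i ∈ s, IsTimeFree (P i)) :
    IsTimeFree (∏ i ∈ s, P i) := fun a => pderiv_prod_of_eq_zero s fun i hi => h i hi a

theorem isTimeFree_pOther (i : ℕ) (Γ : Ptn) : IsTimeFree (ptnPow (pOther i) Γ) :=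
  isTimeFree_prod _ fun a _ b =>
    pderiv_pow_of_eq_zero (MvPowerSeries.pderiv_X_of_ne (by simp [pIdx])) _

/-- The product of the `u_j^{l_j}/l_j!`. -/
def uMonomial {m : ℕ} (ι l : Fin m → ℕ) : PS :=
  ∏ j, (((l j).factorial : ℚ)⁻¹ • uVar (ι j) ^ l j)

theorem isTimeFree_uMonomial {m : ℕ} (ι l : Fin m → ℕ) : IsTimeFree (uMonomial ι l) :=
  isTimeFree_prod _ fun _ _ => isTimeFree_smul (isTimeFree_uVar_pow _ _) _

theorem uVar_pow_dvd_uMonomial {m : ℕ} (ι l : Fin m → ℕ) (j : Fin m) :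
    (MvPowerSeries.X (uIdx (ι j)) : PS) ^ l j ∣ uMonomial ι l := by
  refine dvd_trans ?_ (Finset.dvd_prod_of_mem _ (Finset.mem_univ j))
  rw [Algebra.smul_def]
  exact Dvd.intro_left _ rfl

/-- The product of the powers of the class sums. -/
def classProd (n : ℕ) {m : ℕ} (Δ : Fin m → Ptn) (l : Fin m → ℕ) :
    MonoidAlgebra ℚ (Perm (Fin n)) :=
  (List.ofFn fun j => classElt n (Δ j) ^ l j).prod

/-- The terms of the evolution of `permSeries c P x`. -/
def evolutionTerm {m : ℕ} (ι : Fin m → ℕ) (Δ : Fin m → Ptn) (c : ℤ) (P : PS)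
    (x : MonoidAlgebra ℚ (Perm (Fin n))) (l : Fin m → ℕ) : Series :=
  permSeries (c + ∑ j, l j * ((size (Δ j) : ℤ) - len (Δ j))) (uMonomial ι l * P)
    (x * classProd n Δ l)

theorem evolutionTerm_summable {m : ℕ} (ι : Fin m → ℕ) (Δ : Fin m → Ptn) (c : ℤ) (P : PS)
    (x : MonoidAlgebra ℚ (Perm (Fin n))) : FormallySummable (evolutionTerm ι Δ c P x) :=
  fun e M => by
    refine (Set.finite_Iic (fun j => M (uIdx (ι j)))).subset fun l hl j => ?_
    refine le_of_coeff_pow_dvd ?_ hl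
    rw [evolutionTerm, ← mul_permSeries]
    exact (uVar_pow_dvd_uMonomial ι l j).mul_right _

/-- The operator of `Δ 0` acts last and multiplies on the right, while its class sum stands first in
`classProd`; centrality reconciles the two. The labels `ι` allow the tail of the product to keep its
own variables in the induction. -/
theorem evolution_permSeries {m : ℕ} (ι : Fin m → ℕ) (Δ : Fin m → Ptn) (c : ℤ) {P : PS}
    (hP : IsTimeFree P) (x : MonoidAlgebra ℚ (Perm (Fin n))) :
    (List.ofFn fun j => expOp (ι j) (cutJoin pShift (Δ j))).foldr (fun E G => E G)
      (permSeries c P x) = formalSum (evolutionTerm ι Δ c P x) := by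
  induction m with
  | zero =>
    have h : ∀ l : Fin 0 → ℕ, evolutionTerm ι Δ c P x l = permSeries c P x := fun l => by
      simp [evolutionTerm, uMonomial, classProd]
    rw [formalSum_eq_sum Finset.univ fun l hl => absurd (Finset.mem_univ l) hl,
      Finset.univ_unique, Finset.sum_singleton, h]
    rfl
  | succ m ih =>
    rw [List.ofFn_succ, List.foldr_cons, ih (fun j => ι j.succ) (fun j => Δ j.succ),
      ((finitary_cutJoin (Δ 0)).expOp (ι 0)).map_formalSum (evolutionTerm_summable _ _ _ _ _)]
    have h : ∀ l' : Fin m → ℕ, expOp (ι 0) (cutJoin pShift (Δ 0))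
        (evolutionTerm (fun j => ι j.succ) (fun j => Δ j.succ) c P x l') =
        formalSum fun l₀ : ℕ => evolutionTerm ι Δ c P x (Fin.cons l₀ l') := by
      intro l'
      rw [expOp]
      congr 1
      funext l₀
      rw [evolutionTerm, expOpTerm_permSeries (isTimeFree_mul (isTimeFree_uMonomial _ _) hP),
        evolutionTerm]
      have h1 : uMonomial ι (Fin.cons l₀ l') =
          ((l₀.factorial : ℚ)⁻¹ • uVar (ι 0) ^ l₀) * uMonomial (fun j => ι j.succ) l' := by
        simp [uMonomial, Fin.prod_univ_succ]
      have h2 : classProd n Δ (Fin.cons l₀ l') =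
          classElt n (Δ 0) ^ l₀ * classProd n (fun j => Δ j.succ) l' := by
        simp [classProd, List.ofFn_succ]
      rw [h1, h2, ((classElt_commute (Δ 0) _).pow_left l₀).eq, mul_assoc, mul_assoc]
      congr 2
      rw [Fin.sum_univ_succ]
      simp only [Fin.cons_zero, Fin.cons_succ]
      ring
    simp only [h]
    let E : (Fin m → ℕ) × ℕ ≃ (Fin (m + 1) → ℕ) :=
      (Equiv.prodComm _ _).trans (Fin.consEquiv fun _ => ℕ)
    rw [← formalSum_comp_equiv E, formalSum_prod
      ((evolutionTerm_summable ι Δ c P x).comp_injective E.injective)]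
    rfl

/-! #### Products of class sums and monodromy data -/

theorem prod_ofFn_sum_single {α G : Type*} [Fintype α] [Monoid G] (v : α → G) {r : ℕ}
    (w : Fin r → α → ℚ) :
    (List.ofFn fun i => ∑ s, MonoidAlgebra.single (v s) (w i s)).prod =
      ∑ x : Fin r → α, MonoidAlgebra.single (List.ofFn fun i => v (x i)).prod
        (∏ i, w i (x i)) := by
  induction r with
  | zero => simp [MonoidAlgebra.one_def]
  | succ r ih =>
    rw [List.ofFn_succ, List.prod_cons, ih, Finset.sum_mul_sum,
      ← (Fin.consEquiv fun _ => α).sum_comp, Fintype.sum_prod_type]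
    refine Finset.sum_congr rfl fun s _ => Finset.sum_congr rfl fun x _ => ?_
    rw [MonoidAlgebra.single_mul_single]
    simp [Fin.consEquiv, List.ofFn_succ, Fin.prod_univ_succ]

open Classical in
theorem classElt_eq (Δ : Ptn) : classElt n Δ = ∑ τ : Perm (Fin n), MonoidAlgebra.single τ
    (if HasShiftedType Δ τ then ((n - size Δ + Δ 1).choose (Δ 1) : ℚ) else 0) := by
  rw [classElt, markedPerms, Finset.sum_filter, ← Finset.univ_product_univ, Finset.sum_product]
  refine Finset.sum_congr rfl fun τ _ => ?_
  simp only
  rw [← Finset.sum_filter, Finset.sum_const, card_domains]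
  split_ifs <;> simp [MonoidAlgebra.smul_single]

/-- The sum of all commutators. -/
def commutatorSum (n : ℕ) : MonoidAlgebra ℚ (Perm (Fin n)) :=
  ∑ a : Perm (Fin n) × Perm (Fin n), MonoidAlgebra.single (a.1 * a.2 * a.1⁻¹ * a.2⁻¹) 1

/-- The element of the group algebra that belongs to the genus and to the branching data. -/
def monodromyElt (g n : ℕ) (L : List Ptn) : MonoidAlgebra ℚ (Perm (Fin n)) :=
  commutatorSum n ^ g * (L.map (classElt n)).prod

/-- The product expands into a sum over all tuples. The coefficient of 1 selects those with trivial
product, and each is weighted by the choices of domains for its sᵢ. -/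
theorem coeff_monodromyElt (g n : ℕ) (L : List Ptn) :
    (monodromyElt g n L).coeff 1 = shiftFactor n L * Nat.card (monodromies g n L) := by
  classical
  have h1 : commutatorSum n ^ g = (List.ofFn fun _ : Fin g => commutatorSum n).prod := by simp
  have h2 : L.map (classElt n) = List.ofFn fun i => classElt n (L.get i) := by
    conv_lhs => rw [← List.ofFn_get L, List.map_ofFn]
    rfl
  have h3 : shiftFactor n L =
      ∏ i, ((n - size (L.get i) + L.get i 1).choose (L.get i 1) : ℚ) := by
    rw [shiftFactor, ← List.prod_ofFn]
    conv_lhs => rw [← List.ofFn_get L, List.map_ofFn]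
    rfl
  rw [monodromyElt, h1, h2]
  simp only [commutatorSum, classElt_eq]
  rw [prod_ofFn_sum_single (fun a : Perm (Fin n) × Perm (Fin n) =>
    a.1 * a.2 * a.1⁻¹ * a.2⁻¹), prod_ofFn_sum_single (fun τ : Perm (Fin n) => τ),
    Finset.sum_mul_sum, ← Fintype.sum_prod_type', MonoidAlgebra.coeff_sum,
    Finsupp.finsetSum_apply, Nat.card_eq_fintype_card, ← Set.toFinset_card,
    Finset.card_eq_sum_ones, Nat.cast_sum, Finset.mul_sum]
  rw [← Finset.sum_filter_add_sum_filter_not Finset.univ (· ∈ monodromies g n L),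
    Finset.sum_eq_zero (s := Finset.univ.filter (· ∉ monodromies g n L)), add_zero]
  · refine Finset.sum_congr (by ext; simp) fun x hx => ?_
    have hx : x ∈ monodromies g n L := Set.mem_toFinset.1 hx
    rw [MonoidAlgebra.single_mul_single, MonoidAlgebra.coeff_single, hx.2, Finsupp.single_eq_same,
      h3, Finset.prod_const_one, one_mul, Nat.cast_one, mul_one]
    exact Finset.prod_congr rfl fun i _ => if_pos (hx.1 i)
  · intro x hx
    have hx : x ∉ monodromies g n L := (Finset.mem_filter.1 hx).2
    rw [MonoidAlgebra.single_mul_single, MonoidAlgebra.coeff_single]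
    by_cases ht : ∀ i, HasShiftedType (L.get i) (x.2 i)
    · rw [Finsupp.single_eq_of_ne]
      exact fun h => hx ⟨ht, h.symm⟩
    · obtain ⟨i, hi⟩ := not_forall.1 ht
      rw [Finset.prod_eq_zero (Finset.mem_univ i) (if_neg hi)]
      simp

theorem coeff_mul_classElt (x : MonoidAlgebra ℚ (Perm (Fin n))) (Γ : Ptn) :
    (x * classElt n Γ).coeff 1 = ∑ p ∈ markedPerms n Γ, x.coeff p.1⁻¹ := by
  rw [classElt, Finset.mul_sum, MonoidAlgebra.coeff_sum, Finsupp.finsetSum_apply]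
  refine Finset.sum_congr rfl fun p _ => ?_
  rw [MonoidAlgebra.coeff_mul_single_eq_coeff_mul p.1⁻¹, mul_one]
  intro τ _
  exact mul_eq_one_iff_eq_inv

end GroupAlgebra

/-! ### Generating functions -/

section Generating

variable {n : ℕ}

theorem totalColength_append (L L' : List Ptn) :
    totalColength (L ++ L') = totalColength L + totalColength L' := by
  simp [totalColength]

theorem shiftedHurwitz_eq (g n : ℕ) (L : List Ptn) :
    shiftedHurwitz g (sourceGenus g n L) n L = (monodromyElt g n L).coeff 1 / n.factorial := by
  classical
  rw [coeff_monodromyElt, shiftedHurwitz, hurwitz, mul_div_assoc]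
  split_ifs with h
  · rfl
  · have : IsEmpty (monodromies g n L) :=
      ⟨fun x => h (riemannHurwitz_of_even _ _ (even_totalColength x.2))⟩
    simp

theorem nonempty_of_shiftedHurwitz_ne_zero {g n : ℕ} {L : List Ptn}
    (h : shiftedHurwitz g (sourceGenus g n L) n L ≠ 0) : (monodromies g n L).Nonempty := by
  rw [shiftedHurwitz_eq, coeff_monodromyElt] at h
  by_contra hne
  rw [Set.not_nonempty_iff_eq_empty] at hne
  simp [hne] at h

/-- The integer division in `sourceGenus` is exact whenever the Hurwitz number is nonzero, so the
exponent may be replaced by one that is additive in the branching data. -/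
theorem zMonomial_shiftedHurwitz (g n : ℕ) (L : List Ptn) (P : PS) :
    zMonomial (2 * sourceGenus g n L - 2) (shiftedHurwitz g (sourceGenus g n L) n L • P) =
      zMonomial ((2 * (g : ℤ) - 2) * n + totalColength L)
        (((monodromyElt g n L).coeff 1 / n.factorial) • P) := by
  rw [← shiftedHurwitz_eq]
  by_cases h : shiftedHurwitz g (sourceGenus g n L) n L = 0
  · simp [h, zMonomial]
  · obtain ⟨x, hx⟩ := nonempty_of_shiftedHurwitz_ne_zero h
    rw [two_mul_sourceGenus g n (even_totalColength hx)]

theorem monodromyElt_append_singleton (g n : ℕ) (L : List Ptn) (Γ : Ptn) :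
    monodromyElt g n (L ++ [Γ]) = monodromyElt g n L * classElt n Γ := by
  simp [monodromyElt, mul_assoc]

/-- The source of the shift: each fixed point contributes p₁ inside `d` and 1 outside, and the
binomial theorem adds this up to a power of p₁ + 1. -/
theorem sum_domains (τ : Perm (Fin n)) :
    ∑ d ∈ Finset.univ.filter (fun d => τ.support ⊆ d), ptnPow pVar (typeOn τ d) =
      ptnPow pShift (ptype τ) := by
  have h1 : ptnPow pShift (ofParts τ.cycleType) = ptnPow pVar (ofParts τ.cycleType) := by
    refine Finset.prod_congr rfl fun a ha => ?_
    have : a ≠ 1 := by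
      rintro rfl
      simp only [Finsupp.mem_support_iff] at ha
      exact ha (ofParts_cycleType_one τ)
    simp [pShift, this]
  have h2 : ∀ d : Finset (Fin n), ptnPow pVar (typeOn τ d) =
      ptnPow pVar (ofParts τ.cycleType) * pVar 1 ^ (d.card - τ.support.card) := fun d => by
    rw [typeOn, ptnPow_add, ptnPow_single]
  have h3 : pShift 1 = pVar 1 + 1 := by simp [pShift]
  simp only [h2]
  rw [← Finset.mul_sum, ptype, typeOn, ptnPow_add, h1, ptnPow_single, h3]
  congr 1
  have h4 : (Finset.univ : Finset (Fin n)).card - τ.support.card = (τ.supportᶜ).card := by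
    rw [Finset.card_compl, Finset.card_univ]
  rw [h4, ← Finset.sum_pow_mul_eq_add_pow]
  refine Finset.sum_bij' (fun d _ => d \ τ.support) (fun e _ => τ.support ∪ e) ?_ ?_ ?_ ?_ ?_
  · intro d _
    rw [Finset.mem_powerset]
    exact fun x hx => by simp at hx ⊢; tauto
  · intro e _
    simp
  · intro d hd
    exact Finset.union_sdiff_of_subset (Finset.mem_filter.1 hd).2
  · intro e he
    exact Finset.union_sdiff_cancel_left
      ((Finset.subset_compl_iff_disjoint_left).1 (Finset.mem_powerset.1 he))
  · intro d hd
    rw [Finset.card_sdiff_of_subset (Finset.mem_filter.1 hd).2]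
    simp

theorem zMonomial_sum {ι : Type*} (c : ℤ) (s : Finset ι) (f : ι → PS) :
    zMonomial c (∑ i ∈ s, f i) = ∑ i ∈ s, zMonomial c (f i) :=
  funext fun e => by
    by_cases h : e = c
    · subst h; simp [zMonomial]
    · simp [zMonomial, h]

/-- The partitions of size at most `n`. -/
def ptnsLe (n : ℕ) : Finset Ptn := (finite_size_le n).toFinset

/-- Summation over the type of the last branch point. -/
theorem sum_last (c : ℤ) (P : PS) (r : ℚ) (x : MonoidAlgebra ℚ (Perm (Fin n))) :
    ∑ Γ ∈ ptnsLe n, zMonomial (c + ((size Γ : ℤ) - len Γ))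
      (((x * classElt n Γ).coeff 1 / r) • (P * ptnPow pVar Γ)) =
      permSeries (c + n) (r⁻¹ • P) x := by
  have h1 : ∀ Γ, zMonomial (c + ((size Γ : ℤ) - len Γ))
      (((x * classElt n Γ).coeff 1 / r) • (P * ptnPow pVar Γ)) =
      ∑ p ∈ markedPerms n Γ, zMonomial (c + n - len (ptype p.1))
        ((x.coeff p.1⁻¹ / r) • (P * ptnPow pVar (typeOn p.1 p.2))) := by
    intro Γ
    rw [coeff_mul_classElt, Finset.sum_div, Finset.sum_smul, zMonomial_sum]
    refine Finset.sum_congr rfl fun p hp => ?_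
    obtain ⟨hsupp, rfl⟩ := mem_markedPerms.1 hp
    rw [colength_typeOn _ hsupp, Fintype.card_fin, add_sub_assoc]
  have h2 : ∀ Γ, markedPerms n Γ = ((Finset.univ : Finset (Perm (Fin n) × Finset (Fin n))).filter
      fun p => p.1.support ⊆ p.2).filter fun p => typeOn p.1 p.2 = Γ := fun Γ => by
    rw [markedPerms, Finset.filter_filter]
  simp only [h1, h2]
  rw [Finset.sum_fiberwise_of_maps_to 
    (g := fun p : Perm (Fin n) × Finset (Fin n) => typeOn p.1 p.2)]
  -- The coefficient of 1 in xτ is that of τ⁻¹ in x; the substitution τ ↦ τ⁻¹ preserves types.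
  · rw [Finset.sum_filter, ← Finset.univ_product_univ, Finset.sum_product, permSeries_apply,
      ← Equiv.sum_comp (Equiv.inv (Perm (Fin n)))]
    refine Finset.sum_congr rfl fun τ _ => ?_
    simp only [Equiv.inv_apply]
    rw [← Finset.sum_filter, ← zMonomial_sum, ← Finset.smul_sum, ← Finset.mul_sum, sum_domains,
      monom, ← zMonomial_smul, ptype_inv, smul_mul_assoc, smul_smul, div_eq_mul_inv, inv_inv]
  · intro p hp
    rw [ptnsLe, Set.Finite.mem_toFinset]
    change size _ ≤ n
    rw [size_typeOn (Finset.mem_filter.1 hp).2]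
    simpa using p.2.card_le_univ

/-! #### Formal summability -/

theorem genTerm_eq (g : ℕ) {m : ℕ} (Δ : Fin m → Ptn) (k n : ℕ)
    (x : (Fin m → ℕ) × (Fin k → Ptn) × Ptn) :
    genTerm g Δ k n x =
      zMonomial ((2 * (g : ℤ) - 2) * n + totalColength (branching Δ x.1 x.2.1 x.2.2))
        (((monodromyElt g n (branching Δ x.1 x.2.1 x.2.2)).coeff 1 / n.factorial) •
          (uMonomial (fun j => j) x.1 * (∏ i : Fin k, ptnPow (pOther i) (x.2.1 i)) *
            ptnPow pVar x.2.2)) :=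
  zMonomial_shiftedHurwitz _ _ _ _

theorem dvd_ptnPow (x : ℕ+ → PS) (Γ : Ptn) (a : ℕ+) : x a ^ Γ a ∣ ptnPow x Γ := by
  by_cases h : a ∈ Γ.support
  · exact Finset.dvd_prod_of_mem (fun a => x a ^ Γ a) h
  · rw [Finsupp.notMem_support_iff.1 h, pow_zero]
    exact one_dvd _

/-- The indices whose terms may contain the monomial with exponent `M`. -/
def indicesBelow (m k : ℕ) (M : Var →₀ ℕ) : Set ((Fin m → ℕ) × (Fin k → Ptn) × Ptn) :=
  {x | (∀ j : Fin m, x.1 j ≤ M (uIdx j)) ∧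
    (∀ (i : Fin k) (a : ℕ+), x.2.1 i a ≤ M (Sum.inr (Sum.inl ((i : ℕ), a)))) ∧
    ∀ a, x.2.2 a ≤ M (pIdx a)}

theorem finite_indicesBelow (m k : ℕ) (M : Var →₀ ℕ) : (indicesBelow m k M).Finite := by
  have hinj : ∀ i : ℕ, Function.Injective fun a : ℕ+ => (Sum.inr (Sum.inl (i, a)) : Var) :=
    fun i a b h => by simpa using h
  refine ((Set.finite_Iic fun j : Fin m => M (uIdx j)).prod
    ((Set.Finite.pi' fun i : Fin k => Set.finite_Iic
      (Finsupp.comapDomain (fun a : ℕ+ => (Sum.inr (Sum.inl ((i : ℕ), a)) : Var)) M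
        (hinj i).injOn)).prod
      (Set.finite_Iic (Finsupp.comapDomain pIdx M pIdx_injective.injOn)))).subset ?_
  rintro ⟨l, Γs, Γ⟩ ⟨h1, h2, h3⟩
  refine ⟨h1, fun i a => ?_, fun a => ?_⟩
  · rw [Finsupp.comapDomain_apply]; exact h2 i a
  · rw [Finsupp.comapDomain_apply]; exact h3 a

theorem coeff_zMonomial_ne_zero {c e : ℤ} {P : PS} {M : Var →₀ ℕ}
    (h : (zMonomial c P).coeff e M ≠ 0) : e = c ∧ MvPowerSeries.coeff M P ≠ 0 := by
  unfold zMonomial Series.coeff at h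
  by_cases he : e = c
  · subst he
    rw [Pi.single_eq_same] at h
    exact ⟨rfl, h⟩
  · rw [Pi.single_eq_of_ne he] at h
    exact absurd (map_zero _) h

theorem genTerm_coeff_ne_zero {g m : ℕ} {Δ : Fin m → Ptn} {k n : ℕ}
    {x : (Fin m → ℕ) × (Fin k → Ptn) × Ptn} {e : ℤ} {M : Var →₀ ℕ}
    (h : (genTerm g Δ k n x).coeff e M ≠ 0) :
    x ∈ indicesBelow m k M ∧
      e = (2 * (g : ℤ) - 2) * n + totalColength (branching Δ x.1 x.2.1 x.2.2) := by
  rw [genTerm_eq] at h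
  obtain ⟨he, h⟩ := coeff_zMonomial_ne_zero h
  rw [map_smul] at h
  have h := right_ne_zero_of_mul h
  refine ⟨⟨fun j => le_of_coeff_pow_dvd ?_ h, fun i a => le_of_coeff_pow_dvd ?_ h,
    fun a => le_of_coeff_pow_dvd ?_ h⟩, he⟩
  · exact ((uVar_pow_dvd_uMonomial (fun j => (j : ℕ)) x.1 j).mul_right _).mul_right _
  · exact (((dvd_ptnPow (pOther i) (x.2.1 i) a).trans
      (Finset.dvd_prod_of_mem (fun i : Fin k => ptnPow (pOther i) (x.2.1 i))
        (Finset.mem_univ i))).mul_left _).mul_right _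
  · exact (dvd_ptnPow pVar x.2.2 a).mul_left _

theorem genTerm_summable (g : ℕ) {m : ℕ} (Δ : Fin m → Ptn) (k n : ℕ) :
    FormallySummable (genTerm g Δ k n) := fun _ M =>
  (finite_indicesBelow m k M).subset fun _ hx => (genTerm_coeff_ne_zero hx).1

/-- The monomial leaves finitely many branching data, and for each of them the exponent of z
determines n, because 2g - 2 ≠ 0. -/
theorem genTerm_summable_all {g m : ℕ} (Δ : Fin m → Ptn) (k : ℕ) (hg : g ≠ 1) :
    FormallySummable fun y : ℕ × (Fin m → ℕ) × (Fin k → Ptn) × Ptn =>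
      genTerm g Δ k y.1 y.2 := fun e M => by
  refine Set.Finite.of_finite_image (f := Prod.snd)
    ((finite_indicesBelow m k M).subset ?_) ?_
  · rintro _ ⟨y, hy, rfl⟩
    exact (genTerm_coeff_ne_zero hy).1
  · rintro ⟨n, x⟩ hn ⟨n', x'⟩ hn' (rfl : x = x')
    have h1 := (genTerm_coeff_ne_zero hn).2
    have h2 := (genTerm_coeff_ne_zero hn').2
    rw [h1] at h2
    have h3 : (2 * (g : ℤ) - 2) * n = (2 * (g : ℤ) - 2) * n' := add_right_cancel h2
    have h4 : (2 * (g : ℤ) - 2) ≠ 0 := by omega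
    have h5 : (n : ℤ) = n' := mul_left_cancel₀ h4 h3
    rw [Nat.cast_inj.1 h5]

theorem FormallySummable.prod_fst {ι κ : Type*} {f : ι × κ → Series} (hf : FormallySummable f) :
    FormallySummable fun i => formalSum fun k => f (i, k) := fun e M => by
  refine ((hf e M).image Prod.fst).subset fun i hi => ?_
  by_contra hcon
  refine hi ?_
  rw [coeff_formalSum, finsum_eq_zero_of_forall_eq_zero]
  intro k
  by_contra hk
  exact hcon ⟨(i, k), hk, rfl⟩

/-! #### The sum over the last branch point and over the numbers of points -/

theorem size_le_of_genTerm_ne_zero {g m : ℕ} {Δ : Fin m → Ptn} {k n : ℕ} {l : Fin m → ℕ}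
    {Γs : Fin k → Ptn} {Γ : Ptn} (h : genTerm g Δ k n (l, Γs, Γ) ≠ 0) : size Γ ≤ n := by
  by_contra hlt
  refine h ?_
  have h0 : classElt n Γ = 0 := by
    refine Finset.sum_eq_zero fun p hp => ?_
    obtain ⟨hsupp, rfl⟩ := mem_markedPerms.1 hp
    rw [size_typeOn hsupp] at hlt
    exact absurd (by simpa using p.2.card_le_univ) hlt
  rw [genTerm_eq, branching, monodromyElt_append_singleton, h0]
  simp [zMonomial]

theorem totalColength_replicates {m : ℕ} (Δ : Fin m → Ptn) (l : Fin m → ℕ) :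
    totalColength (List.ofFn fun j => List.replicate (l j) (Δ j)).flatten =
      ∑ j, l j * ((size (Δ j) : ℤ) - len (Δ j)) := by
  rw [← List.sum_ofFn, totalColength, List.map_flatten, List.sum_flatten, List.map_ofFn,
    List.map_ofFn]
  congr 2
  funext j
  simp

theorem prod_replicates (n : ℕ) {m : ℕ} (Δ : Fin m → Ptn) (l : Fin m → ℕ) :
    ((List.ofFn fun j => List.replicate (l j) (Δ j)).flatten.map (classElt n)).prod =
      classProd n Δ l := by
  rw [classProd, List.map_flatten, List.prod_flatten, List.map_ofFn, List.map_ofFn]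
  congr 2
  funext j
  simp

theorem classProd_commute (n : ℕ) {m : ℕ} (Δ : Fin m → Ptn) (l : Fin m → ℕ)
    (x : MonoidAlgebra ℚ (Perm (Fin n))) : Commute (classProd n Δ l) x := by
  refine Commute.list_prod_left _ _ fun y hy => ?_
  obtain ⟨j, rfl⟩ := (List.mem_ofFn' _ _).1 hy
  exact (classElt_commute (Δ j) x).pow_left (l j)

/-- The sum over the type of the last branch point is a term of the evolution. -/
theorem formalSum_last (g : ℕ) {m : ℕ} (Δ : Fin m → Ptn) (k n : ℕ) (l : Fin m → ℕ)
    (Γs : Fin k → Ptn) :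
    (formalSum fun Γ => genTerm g Δ k n (l, Γs, Γ)) =
      evolutionTerm (fun j => (j : ℕ)) Δ
        ((2 * (g : ℤ) - 2) * n + totalColength (List.ofFn Γs) + n)
        ((n.factorial : ℚ)⁻¹ • ∏ i : Fin k, ptnPow (pOther i) (Γs i))
        (monodromyElt g n (List.ofFn Γs)) l := by
  rw [formalSum_eq_sum (ptnsLe n)]
  · have h1 : ∀ Γ, genTerm g Δ k n (l, Γs, Γ) = zMonomial
        ((2 * (g : ℤ) - 2) * n + totalColength ((List.ofFn fun j =>
          List.replicate (l j) (Δ j)).flatten ++ List.ofFn Γs) + ((size Γ : ℤ) - len Γ))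
        (((monodromyElt g n ((List.ofFn fun j => List.replicate (l j) (Δ j)).flatten ++
          List.ofFn Γs) * classElt n Γ).coeff 1 / n.factorial) •
          ((uMonomial (fun j => (j : ℕ)) l * ∏ i : Fin k, ptnPow (pOther i) (Γs i)) *
            ptnPow pVar Γ)) := by
      intro Γ
      rw [genTerm_eq, branching, totalColength_append _ [Γ], monodromyElt_append_singleton,
        add_assoc]
      simp [totalColength]
    rw [Finset.sum_congr rfl fun Γ _ => h1 Γ, sum_last, evolutionTerm, mul_smul_comm]
    have h2 : monodromyElt g n ((List.ofFn fun j => List.replicate (l j) (Δ j)).flatten ++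
        List.ofFn Γs) = monodromyElt g n (List.ofFn Γs) * classProd n Δ l := by
      rw [monodromyElt, monodromyElt, List.map_append, List.prod_append, prod_replicates,
        (classProd_commute n Δ l _).eq, mul_assoc]
    rw [h2, totalColength_append, totalColength_replicates]
    congr 2
    ring
  · intro Γ hΓ
    by_contra h
    exact hΓ ((Set.Finite.mem_toFinset _).2 (size_le_of_genTerm_ne_zero h))

/-- The order of summation is chosen for the evolution: Γ innermost yields an image of the group
algebra, `l` next yields the exponentials, and the outer sum over `Γs` is passed by finitarity. -/
theorem genFunDeg_eq (g : ℕ) {m : ℕ} (Δ : Fin m → Ptn) (k n : ℕ) :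
    FormallySummable (fun Γs : Fin k → Ptn => formalSum fun l : Fin m → ℕ =>
        formalSum fun Γ => genTerm g Δ k n (l, Γs, Γ)) ∧
      genFunDeg g Δ k n = formalSum fun Γs : Fin k → Ptn => formalSum fun l : Fin m → ℕ =>
        formalSum fun Γ => genTerm g Δ k n (l, Γs, Γ) := by
  let E : ((Fin k → Ptn) × (Fin m → ℕ)) × Ptn ≃ (Fin m → ℕ) × (Fin k → Ptn) × Ptn :=
    ((Equiv.prodComm _ _).prodCongr (Equiv.refl _)).trans (Equiv.prodAssoc _ _ _)
  have h := (genTerm_summable g Δ k n).comp_injective E.injective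
  refine ⟨h.prod_fst.prod_fst, ?_⟩
  rw [genFunDeg, ← formalSum_comp_equiv E, formalSum_prod h, formalSum_prod h.prod_fst]
  rfl

theorem isTimeFree_initial (n k : ℕ) (Γs : Fin k → Ptn) :
    IsTimeFree ((n.factorial : ℚ)⁻¹ • ∏ i : Fin k, ptnPow (pOther i) (Γs i)) :=
  isTimeFree_smul (isTimeFree_prod _ fun _ _ => isTimeFree_pOther _ _) _

/-- This is the empty evolution, the case m = 0 of `evolution_permSeries`. -/
theorem formalSum_initial (g k n : ℕ) (Γs : Fin k → Ptn) :
    (formalSum fun l : Fin 0 → ℕ => formalSum fun Γ => genTerm g Fin.elim0 k n (l, Γs, Γ)) =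
      permSeries ((2 * (g : ℤ) - 2) * n + totalColength (List.ofFn Γs) + n)
        ((n.factorial : ℚ)⁻¹ • ∏ i : Fin k, ptnPow (pOther i) (Γs i))
        (monodromyElt g n (List.ofFn Γs)) := by
  simp only [formalSum_last]
  exact (evolution_permSeries _ _ _ (isTimeFree_initial n k Γs) _).symm

theorem genFunDeg_evolution (g : ℕ) {m : ℕ} (Δ : Fin m → Ptn) (k n : ℕ) :
    genFunDeg g Δ k n = evolution Δ (genFunDeg g Fin.elim0 k n) := by
  obtain ⟨hs, h0⟩ := genFunDeg_eq g Fin.elim0 k n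
  have hfin := finitary_evolution (fun j : Fin m => (j : ℕ)) Δ
  rw [h0, (genFunDeg_eq g Δ k n).2]
  refine Eq.trans ?_ (hfin.map_formalSum hs).symm
  congr 1
  funext Γs
  rw [formalSum_initial, evolution_permSeries _ _ _ (isTimeFree_initial n k Γs)]
  congr 1
  funext l
  exact formalSum_last g Δ k n l Γs

theorem genFun_evolution {g m : ℕ} (Δ : Fin m → Ptn) (k : ℕ) (hg : g ≠ 1) :
    genFun g Δ k = evolution Δ (genFun g Fin.elim0 k) := by
  have hfin := finitary_evolution (fun j : Fin m => (j : ℕ)) Δ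
  have h0 := genTerm_summable_all (g := g) Fin.elim0 k hg
  rw [genFun, genFun, formalSum_prod h0, formalSum_prod (genTerm_summable_all Δ k hg)]
  refine Eq.trans ?_ (hfin.map_formalSum h0.prod_fst).symm
  congr 1
  funext n
  exact genFunDeg_evolution g Δ k n

/-! #### The sphere -/

theorem expTerm_summable {c : ℤ} (hc : c ≠ 0) (P : PS) : FormallySummable (expTerm c P) :=
  fun e M => by
    refine Set.Subsingleton.finite fun n hn n' hn' => ?_
    have h1 := (coeff_zMonomial_ne_zero hn).1
    have h2 := (coeff_zMonomial_ne_zero hn').1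
    rw [h1] at h2
    exact Nat.cast_inj.1 (mul_left_cancel₀ hc h2)

/-- Without branch points and handles the group algebra element is 1, whose type is 1^n. The
exponent of z is -2n + n - n, and the domains turn p₁^n into (p₁ + 1)^n. -/
theorem genFunDeg_sphere (n : ℕ) :
    genFunDeg 0 (Fin.elim0 : Fin 0 → Ptn) 0 n = expTerm (-2) (pVar 1 + 1) n := by
  have h1 : ptype (1 : Perm (Fin n)) = Finsupp.single 1 n := by simp [ptype, typeOn]
  have h2 : pShift 1 = pVar 1 + 1 := by simp [pShift]
  rw [(genFunDeg_eq 0 Fin.elim0 0 n).2,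
    formalSum_eq_sum Finset.univ fun l hl => absurd (Finset.mem_univ l) hl,
    Finset.univ_unique, Finset.sum_singleton, formalSum_initial]
  have h3 : ∀ Γs : Fin 0 → Ptn, monodromyElt 0 n (List.ofFn Γs) =
      MonoidAlgebra.single 1 1 := fun Γs => by
    simp [monodromyElt, MonoidAlgebra.one_def]
  rw [h3, permSeries_single, one_smul, h1, monom, expTerm, ptnPow_single, h2, len_single]
  congr 1
  · simp [totalColength]
  · simp

theorem genFun_sphere :
    genFun 0 (Fin.elim0 : Fin 0 → Ptn) 0 = formalExp (-2) (pVar 1 + 1) := by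
  rw [genFun, formalSum_prod (genTerm_summable_all _ _ zero_ne_one), formalExp]
  congr 1
  funext n
  exact genFunDeg_sphere n

end Generating

end ShiftedHurwitz

end

/-! ### The theorem -/

theorem mainTheorem5 :
    -- the shifted cut-and-join operators are well defined on all formal series
    (∀ (Δ : ShiftedHurwitz.Ptn) (F : ShiftedHurwitz.Series),
      ShiftedHurwitz.FormallySummable
        (ShiftedHurwitz.cutJoinTerm ShiftedHurwitz.pShift Δ F)) ∧
    -- the identity for the coverings of each degree `n`, for every genus `g`
    (∀ (g m : ℕ) (Δ : Fin m → ShiftedHurwitz.Ptn) (k n : ℕ),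
      ShiftedHurwitz.FormallySummable (ShiftedHurwitz.genTerm g Δ k n) ∧
      ShiftedHurwitz.genFunDeg g Δ k n =
        ShiftedHurwitz.evolution Δ (ShiftedHurwitz.genFunDeg g Fin.elim0 k n)) ∧
    -- the identity for the whole generating function
    (∀ (g m : ℕ) (Δ : Fin m → ShiftedHurwitz.Ptn) (k : ℕ), g ≠ 1 →
      ShiftedHurwitz.FormallySummable
        (fun y : ℕ × (Fin m → ℕ) × (Fin k → ShiftedHurwitz.Ptn) × ShiftedHurwitz.Ptn =>
          ShiftedHurwitz.genTerm g Δ k y.1 y.2) ∧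
      ShiftedHurwitz.genFun g Δ k =
        ShiftedHurwitz.evolution Δ (ShiftedHurwitz.genFun g Fin.elim0 k)) ∧
    -- the example `Φ_0{z||p} = exp ((p_1 + 1) / z^2)`
    (ShiftedHurwitz.FormallySummable
        (ShiftedHurwitz.expTerm (-2) (ShiftedHurwitz.pVar 1 + 1)) ∧
      ShiftedHurwitz.genFun 0 (Fin.elim0 : Fin 0 → ShiftedHurwitz.Ptn) 0 =
        ShiftedHurwitz.formalExp (-2) (ShiftedHurwitz.pVar 1 + 1)) :=
  ⟨ShiftedHurwitz.cutJoinTerm_summable,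
    fun g _ Δ k n => ⟨ShiftedHurwitz.genTerm_summable g Δ k n,
      ShiftedHurwitz.genFunDeg_evolution g Δ k n⟩,
    fun _ _ Δ k hg => ⟨ShiftedHurwitz.genTerm_summable_all Δ k hg,
      ShiftedHurwitz.genFun_evolution Δ k hg⟩,
    ShiftedHurwitz.expTerm_summable (by norm_num) _, ShiftedHurwitz.genFun_sphere⟩
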